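/- An election consists of a finite set $\mathcal{C}$ of $m$ candidates and a finite multiset $\Pi_{\mathcal{V}}$ of $n$ votes, each vote being a linear order $\pi$ of $\mathcal{C}$, where $\pi(c)$ denotes the position of the candidate $c$ in the vote. A vote $\pi$ is single-peaked with respect to a linear order (axis) $\lhd$ of $\mathcal{C}$ if for all $a,b,c\in\mathcal{C}$ with $a\lhd b\lhd c$ or $c\lhd b\lhd a$, $\pi(c)<\pi(b)$ implies $\pi(b)<\pi(a)$. An election is a $2$-axes election if there are two axes $\lhd_1,\lhd_2$ such that every vote is single-peaked with respect to at least one of them. Theorem. Determining whether a given election (presented by $m$, $n$ and the table of the positions $\pi(c)$) is a $2$-axes election is polynomial-time solvable: it is decided by a random access machine whose logarithmic cost is polynomially bounded in the bit length of the input. In particular, it can be solved in $O(n^2\cdot m^3\cdot (n+m))$ time (in $O(1)$ time if $n=0$ or $m=0$), where $m$ and $n$ denote the number of candidates and the number of votes, and time is the number of steps of a random access machine with addition, truncated subtraction, multiplication, indirect addressing and conditional jumps, all of whose words have $O(\log(n+m+2))$ bits. -/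

import Mathlib

/-! ### Elections -/

/-- An election with candidates `0, …, m - 1` and a finite family of votes (repetitions allowed).
A vote is a linear order of the candidates, given by its position function: `π c` is the position
of candidate `c`, and `π c < π c'` says that `c` is ranked above `c'`. -/
structure Election where
  m : ℕ
  votes : List (Equiv.Perm (Fin m))

namespace Election

/-- The number of votes. -/
def n (E : Election) : ℕ := E.votes.length

/-- The vote `π` is single-peaked with respect to the axis `ax`
(used for strict linear orders `ax`). -/
def SinglePeakedWrt {m : ℕ} (π : Equiv.Perm (Fin m)) (ax : Fin m → Fin m → Prop) : Prop :=
  ∀ a b c : Fin m, ((ax a b ∧ ax b c) ∨ (ax c b ∧ ax b a)) → π c < π b → π b < π a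

/-- There are `k` axes (strict linear orders of the candidates) such that every vote is
single-peaked with respect to at least one of them. -/
def IsKAxes (k : ℕ) (E : Election) : Prop :=
  ∃ ax : Fin k → Fin E.m → Fin E.m → Prop,
    (∀ i, IsStrictTotalOrder (Fin E.m) (ax i)) ∧
      ∀ π ∈ E.votes, ∃ i, SinglePeakedWrt π (ax i)

/-- The encoding of an election as a sequence of numbers: the number of candidates, the number of
votes, and then, vote by vote, the positions of the candidates `0, …, m - 1` in that vote. -/
def encode (E : Election) : List ℕ :=
  E.m :: E.n :: E.votes.flatMap fun π => List.ofFn fun c => (π c : ℕ)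

end Election

/-! ### Random access machines -/

namespace RAM

/-- Instructions of a random access machine. It has registers, which are addressed directly, and
a memory, which is addressed indirectly through registers; all of them hold natural numbers. -/
inductive Instr where
  /-- `reg r := k` -/
  | const (r k : ℕ)
  /-- `reg r := reg s` -/
  | copy (r s : ℕ)
  /-- `reg r := reg s + reg t` -/
  | add (r s t : ℕ)
  /-- `reg r := reg s - reg t`, and `0` if this is negative -/
  | sub (r s t : ℕ)
  /-- `reg r := reg s * reg t` -/
  | mul (r s t : ℕ)
  /-- `reg r := mem (reg s)` -/
  | load (r s : ℕ)
  /-- `mem (reg r) := reg s` -/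
  | store (r s : ℕ)
  /-- go to instruction number `l` -/
  | jump (l : ℕ)
  /-- go to instruction number `l` if `reg r = 0` -/
  | jumpZero (r l : ℕ)

/-- A program is a finite list of instructions. -/
abbrev Program := List Instr

/-- A configuration: the number of the next instruction, the registers and the memory. -/
structure Config where
  pc : ℕ
  reg : ℕ → ℕ
  mem : ℕ → ℕ

/-- Write `v` into register `r` and go to the next instruction. -/
def Config.setReg (c : Config) (r v : ℕ) : Config :=
  { c with pc := c.pc + 1, reg := Function.update c.reg r v }

/-- The effect of one instruction. -/
def Instr.exec : Instr → Config → Config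
  | const r k, c => c.setReg r k
  | copy r s, c => c.setReg r (c.reg s)
  | add r s t, c => c.setReg r (c.reg s + c.reg t)
  | sub r s t, c => c.setReg r (c.reg s - c.reg t)
  | mul r s t, c => c.setReg r (c.reg s * c.reg t)
  | load r s, c => c.setReg r (c.mem (c.reg s))
  | store r s, c => { c with pc := c.pc + 1, mem := Function.update c.mem (c.reg r) (c.reg s) }
  | jump l, c => { c with pc := l }
  | jumpZero r l, c => { c with pc := if c.reg r = 0 then l else c.pc + 1 }

/-- The logarithmic cost of one instruction: one plus the total bit length of the numbers, memory
addresses included, that it handles. -/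
def Instr.logCost : Instr → Config → ℕ
  | const _ k, _ => Nat.size k + 1
  | copy _ s, c => Nat.size (c.reg s) + 1
  | add _ s t, c => Nat.size (c.reg s) + Nat.size (c.reg t) + 1
  | sub _ s t, c => Nat.size (c.reg s) + Nat.size (c.reg t) + 1
  | mul _ s t, c => Nat.size (c.reg s) + Nat.size (c.reg t) + 1
  | load _ s, c => Nat.size (c.reg s) + Nat.size (c.mem (c.reg s)) + 1
  | store r s, c => Nat.size (c.reg r) + Nat.size (c.reg s) + 1
  | jump _, _ => 1
  | jumpZero r _, c => Nat.size (c.reg r) + 1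

/-- One step of the program `P`. The machine halts when there is no instruction with the current
number; a halted machine stays as it is. -/
def step (P : Program) (c : Config) : Config :=
  match P[c.pc]? with
  | none => c
  | some i => i.exec c

/-- The logarithmic cost of the step of `P` from `c`; zero if the machine has halted. -/
def stepCost (P : Program) (c : Config) : ℕ :=
  match P[c.pc]? with
  | none => 0
  | some i => i.logCost c

/-- The initial configuration on the input `w`: the input is in the memory cells
`0, …, w.length - 1`; all other cells and all registers are zero. -/
def init (w : List ℕ) : Config :=
  { pc := 0, reg := fun _ => 0, mem := fun k => w.getD k 0 }

/-- The configuration of `P` on the input `w` after `t` steps. -/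
def run (P : Program) (w : List ℕ) (t : ℕ) : Config :=
  (step P)^[t] (init w)

/-- On the input `w`, the program `P` halts after at most `t` steps, and register `0` then holds
the answer to the question whether `b` is true: `1` for yes, `0` for no. -/
def Answers (P : Program) (w : List ℕ) (t : ℕ) (b : Prop) : Prop :=
  P.length ≤ (run P w t).pc ∧
    (b → (run P w t).reg 0 = 1) ∧ (¬ b → (run P w t).reg 0 = 0)

/-- The bit length of an input (binary notation, one separator after each number). -/
def bitLength (w : List ℕ) : ℕ :=
  (w.map fun k => Nat.size k + 1).sum

/-- The decision problem `L`, with instances encoded by `enc`, is solvable in polynomial time: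
some random access machine solves it with a total logarithmic cost that is bounded by a
polynomial in the bit length of the input. -/
def PolyTimeSolvable {α : Type*} (enc : α → List ℕ) (L : α → Prop) : Prop :=
  ∃ (P : Program) (p : Polynomial ℕ), ∀ x, ∃ t,
    Answers P (enc x) t (L x) ∧
      ∑ s ∈ Finset.range t, stepCost P (run P (enc x) s) ≤ p.eval (bitLength (enc x))

/-- The decision problem `L`, with instances encoded by `enc`, is solvable in time `O(T)` on a
random access machine whose words have `O(log N)` bits: there are a program and a constant `C`
such that, on each instance `x`, the program halts with the right answer after at most `C * T x`
steps, and no register or memory cell ever holds a number above `(N x + 2) ^ C`. -/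
def SolvableInTime {α : Type*} (enc : α → List ℕ) (L : α → Prop) (N T : α → ℕ) : Prop :=
  ∃ (P : Program) (C : ℕ), ∀ x, ∃ t ≤ C * T x,
    Answers P (enc x) t (L x) ∧
      ∀ s ≤ t, ∀ k, (run P (enc x) s).reg k ≤ (N x + 2) ^ C ∧
        (run P (enc x) s).mem k ≤ (N x + 2) ^ C

end RAM

/-!
# Recognizing two-axes elections in polynomial time

Votes are single-peaked with respect to a common axis if and only if no three of them are
worst-diverse (three candidates, each of them ranked last among the three by another vote) and no
two of them are opposed (they rank `a, b, c` in opposite ways, with a further candidate above the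
middle one, `b`, in both votes). If these configurations are absent, an axis is built from its ends
to the middle: the candidates ranked last among the unplaced ones, of which there are at most two,
can always be placed at the ends of the gap (`exists_peakedAlong`).

An election thus has two axes iff its votes can be split into two parts without these obstructions.
Obstructions of three votes do not lead to clauses with two literals as they stand. But any vote `v`
ranks one of the three candidates of a worst-diverse triple last, so it forms a worst-diverse triple
with two of the three votes. Hence, for any `v`, it suffices to exclude the worst-diverse triples
that contain `v` (`singlePeaked_of_not_conflict`), and if `v` is known to be in the part, then it is also
necessary. Given a vote for each part, this leaves conditions on pairs of votes. Suitable votes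
are found among three worst-diverse ones, as these are not all in one part; if there is no
worst-diverse triple, any votes do (`twoAxes_iff`). The resulting clauses are satisfiable iff no
literal and its negation imply each other (`exists_partition_iff`), which is decided by Warshall's
algorithm (`warshall`).

Trying all triples of votes and all triples of candidates takes time `O(n³m³)`, trying all pairs of
votes and all quadruples of candidates takes time `O(n²m⁴)`, and Warshall's algorithm takes time
`O(n³)`; together this is `O(n²m³(n + m))`. The algorithm is written in a small structured language
with expressions that contain bounded searches and commands that contain bounded loops. Its compiler
into random access machines is verified once and for all (`Exp.correct`, `Cmd.correct`), including a
bound for the time, which is a function of the values of the variables, and for the words, which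
are at most `B ^ deg` if `B` bounds the variables and the memory cells. Polynomial logarithmic cost
follows from these two bounds (`SolvableInTime.polyTimeSolvable`).
-/

namespace RAM

/-! ### A structured language for the random access machine -/

/-- Expressions with named, immutable variables. `search x N e` looks for `k < N` such that `e` is
nonzero at `x = k`: its value is `k + 1` for the largest such `k`, and `0` if there is none. In
particular, it is nonzero iff such a `k` exists. The bound `N` is the name of a variable. -/
inductive Exp where
  | const (k : ℕ)
  | var (x : ℕ)
  | add (a b : Exp)
  | sub (a b : Exp)
  | mul (a b : Exp)
  | load (a : Exp)
  | search (x N : ℕ) (e : Exp)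

namespace Exp

/-- The value of an expression in the memory `mem` and the environment `ρ`. -/
def eval (mem : ℕ → ℕ) : Exp → (ℕ → ℕ) → ℕ
  | const k, _ => k
  | var x, ρ => ρ x
  | add a b, ρ => a.eval mem ρ + b.eval mem ρ
  | sub a b, ρ => a.eval mem ρ - b.eval mem ρ
  | mul a b, ρ => a.eval mem ρ * b.eval mem ρ
  | load a, ρ => mem (a.eval mem ρ)
  | search x N e, ρ => Nat.findGreatest (fun k => e.eval mem (Function.update ρ x (k - 1)) ≠ 0) (ρ N)

/-- An upper bound for the number of steps that the compiled expression takes. -/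
def cost : Exp → (ℕ → ℕ) → ℕ
  | const _, _ => 1
  | var _, _ => 1
  | add a b, ρ => a.cost ρ + b.cost ρ + 1
  | sub a b, ρ => a.cost ρ + b.cost ρ + 1
  | mul a b, ρ => a.cost ρ + b.cost ρ + 1
  | load a, ρ => a.cost ρ + 1
  | search x N e, ρ => (∑ k ∈ Finset.range (ρ N), (e.cost (Function.update ρ x k) + 7)) + 4

/-- If all variables and memory cells are at most `B`, then all intermediate results are at most
`B ^ deg`. -/
def deg : Exp → ℕ
  | const k => k + 1
  | var _ => 1
  | add a b => a.deg + b.deg + 1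
  | sub a b => a.deg + b.deg
  | mul a b => a.deg + b.deg
  | load a => a.deg + 1
  | search _ _ e => e.deg + 1

/-- A syntactic criterion for the value to be at most `B` if all variables and memory cells are. -/
def small : Exp → Bool
  | const k => k ≤ 2
  | var _ => true
  | add _ _ => false
  | sub a _ => a.small
  | mul _ _ => false
  | load _ => true
  | search _ _ _ => true

/-- The length of the compiled expression. -/
def len : Exp → ℕ
  | const _ => 1
  | var _ => 1
  | add a b => a.len + b.len + 1
  | sub a b => a.len + b.len + 1
  | mul a b => a.len + b.len + 1
  | load a => a.len + 1
  | search _ _ e => e.len + 9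

/-- The code of an expression, to be placed at the address `o` of a program: the variable `x` is
read from the register `σ x`, the value is returned in register `d`, and no register below `d` is
changed. -/
def compile : Exp → (ℕ → ℕ) → ℕ → ℕ → List Instr
  | const k, _, d, _ => [.const d k]
  | var x, σ, d, _ => [.copy d (σ x)]
  | add a b, σ, d, o => a.compile σ d o ++ (b.compile σ (d + 1) (o + a.len) ++ [.add d d (d + 1)])
  | sub a b, σ, d, o => a.compile σ d o ++ (b.compile σ (d + 1) (o + a.len) ++ [.sub d d (d + 1)])
  | mul a b, σ, d, o => a.compile σ d o ++ (b.compile σ (d + 1) (o + a.len) ++ [.mul d d (d + 1)])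
  | load a, σ, d, o => a.compile σ d o ++ [.load d d]
  | search x N e, σ, d, o =>
      .const d 0 :: .const (d + 1) 0 ::
      .sub (d + 2) (σ N) (d + 1) :: .jumpZero (d + 2) (o + e.len + 9) ::
      (e.compile (Function.update σ x (d + 1)) (d + 2) (o + 4) ++
      [.const (d + 3) 1, .add (d + 1) (d + 1) (d + 3), .jumpZero (d + 2) (o + 2),
        .copy d (d + 1), .jump (o + 2)])

@[simp] theorem length_compile (e : Exp) : ∀ σ d o, (e.compile σ d o).length = e.len := by
  induction e <;> intro σ d o <;> simp [compile, len, *] <;> omega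

theorem eval_search_ne_zero {mem : ℕ → ℕ} {x N : ℕ} {e : Exp} {ρ : ℕ → ℕ} :
    (search x N e).eval mem ρ ≠ 0 ↔ ∃ k < ρ N, e.eval mem (Function.update ρ x k) ≠ 0 := by
  rw [eval, Ne, Nat.findGreatest_eq_zero_iff]
  push Not
  constructor
  · rintro ⟨k, h0, hk, h⟩
    exact ⟨k - 1, by omega, h⟩
  · rintro ⟨k, hk, h⟩
    exact ⟨k + 1, by omega, hk, by simpa using h⟩

theorem eval_le_pow {B : ℕ} (hB : 2 ≤ B) {mem : ℕ → ℕ} (hm : ∀ k, mem k ≤ B) (e : Exp) :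
    ∀ {ρ : ℕ → ℕ}, (∀ x, ρ x ≤ B) → e.eval mem ρ ≤ B ^ e.deg := by
  have mono : ∀ {i j}, i ≤ j → B ^ i ≤ B ^ j := fun h => Nat.pow_le_pow_right (by omega) h
  have self : ∀ {j}, 1 ≤ j → B ≤ B ^ j := fun {j} h => by simpa using mono h
  induction e with
  | const k =>
    intro ρ _
    exact (Nat.lt_two_pow_self (n := k)).le.trans
      ((Nat.pow_le_pow_left hB k).trans (mono (Nat.le_succ k)))
  | var x => intro ρ hρ; simpa [eval, deg] using hρ x
  | add a b iha ihb =>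
    intro ρ hρ
    have h1 := (iha hρ).trans (mono (Nat.le_add_right a.deg b.deg))
    have h2 := (ihb hρ).trans (mono (Nat.le_add_left b.deg a.deg))
    simp only [eval, deg, pow_succ _ (a.deg + b.deg)]
    nlinarith
  | sub a b iha ihb =>
    intro ρ hρ
    exact (Nat.sub_le _ _).trans ((iha hρ).trans (mono (Nat.le_add_right _ _)))
  | mul a b iha ihb =>
    intro ρ hρ
    simpa only [eval, deg, pow_add] using Nat.mul_le_mul (iha hρ) (ihb hρ)
  | load a iha => intro ρ hρ; exact (hm _).trans (self (by simp [deg]))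
  | search x N e ih =>
    intro ρ hρ
    exact (Nat.findGreatest_le _).trans ((hρ N).trans (self (by simp [deg])))

theorem eval_le_of_small {B : ℕ} (hB : 2 ≤ B) {mem : ℕ → ℕ} (hm : ∀ k, mem k ≤ B) (e : Exp)
    (he : e.small) {ρ : ℕ → ℕ} (hρ : ∀ x, ρ x ≤ B) : e.eval mem ρ ≤ B := by
  induction e with
  | const k => simp only [small, decide_eq_true_eq] at he; exact he.trans hB
  | var x => exact hρ x
  | add a b => simp [small] at he
  | sub a b iha ihb => exact (Nat.sub_le _ _).trans (iha he)
  | mul a b => simp [small] at he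
  | load a => exact hm _
  | search x N e ih => exact (Nat.findGreatest_le _).trans (hρ N)

end Exp

/-- Commands. `store a e` writes the value of `e` into the memory cell with the value of `a` as its
address, `loop x N c` executes `c` for `x = 0, …, N - 1`, where `N` is the name of a variable, and
`bind x e c` executes `c` with the value of `e` as the value of `x`. -/
inductive Cmd where
  | store (a e : Exp)
  | seq (c c' : Cmd)
  | loop (x N : ℕ) (c : Cmd)
  | bind (x : ℕ) (e : Exp) (c : Cmd)

namespace Cmd

/-- The memory after the execution of a command. -/
def exec : Cmd → (ℕ → ℕ) → (ℕ → ℕ) → (ℕ → ℕ)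
  | store a e, ρ, mem => Function.update mem (a.eval mem ρ) (e.eval mem ρ)
  | seq c c', ρ, mem => c'.exec ρ (c.exec ρ mem)
  | loop x N c, ρ, mem =>
      (ρ N).rec mem fun k mem' => c.exec (Function.update ρ x k) mem'
  | bind x e c, ρ, mem => c.exec (Function.update ρ x (e.eval mem ρ)) mem

/-- The memory after the first `k` rounds of the loop with the body `c`. -/
def iter (c : Cmd) (x : ℕ) (ρ mem : ℕ → ℕ) (k : ℕ) : ℕ → ℕ :=
  k.rec mem fun k mem' => c.exec (Function.update ρ x k) mem'

/-- An upper bound for the number of steps that the compiled command takes. -/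
def cost : Cmd → (ℕ → ℕ) → (ℕ → ℕ) → ℕ
  | store a e, ρ, _ => a.cost ρ + e.cost ρ + 1
  | seq c c', ρ, mem => c.cost ρ mem + c'.cost ρ (c.exec ρ mem)
  | loop x N c, ρ, mem =>
      (∑ k ∈ Finset.range (ρ N), (c.cost (Function.update ρ x k) (c.iter x ρ mem k) + 5)) + 3
  | bind x e c, ρ, mem => e.cost ρ + c.cost (Function.update ρ x (e.eval mem ρ)) mem

/-- If all variables and memory cells are at most `B`, then all intermediate results are at most
`B ^ deg`. -/
def deg : Cmd → ℕ
  | store a e => a.deg + e.deg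
  | seq c c' => c.deg + c'.deg
  | loop _ _ c => c.deg + 1
  | bind _ e c => e.deg + c.deg

/-- All values that are stored or bound to variables stay below `B`. For stored values this is
ensured syntactically, so that memory cells stay small in loops. -/
def Safe (B : ℕ) : Cmd → (ℕ → ℕ) → (ℕ → ℕ) → Prop
  | store _ e, _, _ => e.small
  | seq c c', ρ, mem => c.Safe B ρ mem ∧ c'.Safe B ρ (c.exec ρ mem)
  | loop x N c, ρ, mem => ∀ k < ρ N, c.Safe B (Function.update ρ x k) (c.iter x ρ mem k)
  | bind x e c, ρ, mem =>
      e.eval mem ρ ≤ B ∧ c.Safe B (Function.update ρ x (e.eval mem ρ)) mem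

/-- The length of the compiled command. -/
def len : Cmd → ℕ
  | store a e => a.len + e.len + 1
  | seq c c' => c.len + c'.len
  | loop _ _ c => c.len + 6
  | bind _ e c => e.len + c.len

/-- The code of a command, to be placed at the address `o` of a program: the variable `x` is
read from the register `σ x`, and no register below `d` is changed. -/
def compile : Cmd → (ℕ → ℕ) → ℕ → ℕ → List Instr
  | store a e, σ, d, o =>
      a.compile σ d o ++ (e.compile σ (d + 1) (o + a.len) ++ [.store d (d + 1)])
  | seq c c', σ, d, o => c.compile σ d o ++ c'.compile σ d (o + c.len)
  | loop x N c, σ, d, o =>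
      .const d 0 :: .sub (d + 1) (σ N) d :: .jumpZero (d + 1) (o + c.len + 6) ::
      (c.compile (Function.update σ x d) (d + 1) (o + 3) ++
      [.const (d + 1) 1, .add d d (d + 1), .jump (o + 1)])
  | bind x e c, σ, d, o =>
      e.compile σ d o ++ c.compile (Function.update σ x d) (d + 1) (o + e.len)

@[simp] theorem length_compile (c : Cmd) : ∀ σ d o, (c.compile σ d o).length = c.len := by
  induction c <;> intro σ d o <;> simp [compile, len, *]; omega

@[simp] theorem iter_zero (c : Cmd) (x : ℕ) (ρ mem : ℕ → ℕ) : c.iter x ρ mem 0 = mem := rfl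

theorem iter_succ (c : Cmd) (x : ℕ) (ρ mem : ℕ → ℕ) (k : ℕ) :
    c.iter x ρ mem (k + 1) = c.exec (Function.update ρ x k) (c.iter x ρ mem k) := rfl

theorem exec_loop (c : Cmd) (x N : ℕ) (ρ mem : ℕ → ℕ) :
    (loop x N c).exec ρ mem = c.iter x ρ mem (ρ N) := rfl

end Cmd

/-! ### Correctness of the compiler -/

/-- All registers and memory cells hold numbers that are at most `W`. -/
def Config.Bounded (W : ℕ) (c : Config) : Prop :=
  ∀ k, c.reg k ≤ W ∧ c.mem k ≤ W

/-- Within at most `T` steps, the program `P` leads from `c` to a configuration with the property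
`Q`, and up to then all words are at most `W`. -/
def Runs (P : Program) (W T : ℕ) (Q : Config → Prop) (c : Config) : Prop :=
  ∃ t ≤ T, Q ((step P)^[t] c) ∧ ∀ s ≤ t, ((step P)^[s] c).Bounded W

namespace Runs

variable {P : Program} {W T T' : ℕ} {Q Q' : Config → Prop} {c : Config}

theorem done (hc : c.Bounded W) (hQ : Q c) : Runs P W T Q c :=
  ⟨0, Nat.zero_le _, hQ, fun s hs => by rwa [Nat.le_zero.1 hs]⟩

theorem next {o : ℕ} {i : Instr} (hpc : c.pc = o) (hi : P[o]? = some i) (hc : c.Bounded W)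
    (h : Runs P W T Q (i.exec c)) : Runs P W (T + 1) Q c := by
  obtain ⟨t, ht, hQ, hb⟩ := h
  have hs : step P c = i.exec c := by simp [step, hpc, hi]
  refine ⟨t + 1, by omega, by simpa [hs] using hQ, fun s hst => ?_⟩
  rcases s with _ | s
  · exact hc
  · simpa [hs] using hb s (by omega)

theorem trans (h : Runs P W T Q c) (h' : ∀ c', c'.Bounded W → Q c' → Runs P W T' Q' c') :
    Runs P W (T + T') Q' c := by
  obtain ⟨t, ht, hQ, hb⟩ := h
  obtain ⟨t', ht', hQ', hb'⟩ := h' _ (hb t le_rfl) hQ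
  refine ⟨t' + t, by omega, by simpa [Function.iterate_add_apply] using hQ', fun s hs => ?_⟩
  rcases le_total s t with hst | hst
  · exact hb s hst
  · obtain ⟨r, rfl⟩ := Nat.exists_eq_add_of_le' hst
    simpa [Function.iterate_add_apply] using hb' r (by omega)

theorem mono (h : Runs P W T Q c) (hT : T ≤ T') (hQ : ∀ c', Q c' → Q' c') :
    Runs P W T' Q' c := by
  obtain ⟨t, ht, h1, hb⟩ := h
  exact ⟨t, ht.trans hT, hQ _ h1, hb⟩

end Runs

theorem Config.Bounded.setReg {W : ℕ} {c : Config} (hc : c.Bounded W) {r v : ℕ} (hv : v ≤ W) :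
    (c.setReg r v).Bounded W := by
  intro k
  refine ⟨?_, (hc k).2⟩
  by_cases h : k = r
  · subst h; simpa [Config.setReg] using hv
  · simpa [Config.setReg, h] using (hc k).1

/-- The program `P` contains the code `l` at the address `o`. -/
def CodeAt (P : Program) (o : ℕ) : List Instr → Prop
  | [] => True
  | i :: l => P[o]? = some i ∧ CodeAt P (o + 1) l

theorem codeAt_append {P : Program} {o : ℕ} {l l' : List Instr} :
    CodeAt P o (l ++ l') ↔ CodeAt P o l ∧ CodeAt P (o + l.length) l' := by
  induction l generalizing o with
  | nil => simp [CodeAt]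
  | cons i l ih => simp [CodeAt, ih, and_assoc, Nat.add_assoc, Nat.add_comm 1]

/-- Generalized to a prefix for the induction. -/
theorem codeAt_self_aux (P l : List Instr) : CodeAt (P ++ l) P.length l := by
  induction l generalizing P with
  | nil => trivial
  | cons i l ih => exact ⟨by simp, by simpa using ih (P ++ [i])⟩

theorem codeAt_self (P : Program) : CodeAt P 0 P := codeAt_self_aux [] P

/-- The registers hold the values of the variables, below register `d`. -/
def Holds (σ : ℕ → ℕ) (d : ℕ) (ρ reg : ℕ → ℕ) : Prop :=
  ∀ x, σ x < d ∧ reg (σ x) = ρ x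

theorem Holds.congr {σ ρ reg reg' : ℕ → ℕ} {d d' : ℕ} (h : Holds σ d ρ reg) (hd : d ≤ d')
    (hr : ∀ r < d, reg' r = reg r) : Holds σ d' ρ reg' :=
  fun x => ⟨(h x).1.trans_le hd, (hr _ (h x).1).trans (h x).2⟩

theorem Holds.update {σ ρ reg reg' : ℕ → ℕ} {d e d' x k : ℕ} (h : Holds σ d ρ reg) (hd : d ≤ e)
    (he : e < d') (hr : ∀ r < d, reg' r = reg r) (hk : reg' e = k) :
    Holds (Function.update σ x e) d' (Function.update ρ x k) reg' := by
  intro y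
  by_cases hy : y = x
  · subst hy; simp [he, hk]
  · simpa [hy] using h.congr (by omega : d ≤ d') hr y

/-- What the compiled expression `e`, placed at the address `o` and started in `c`, achieves. -/
def Exp.Post (e : Exp) (ρ : ℕ → ℕ) (d o : ℕ) (c c' : Config) : Prop :=
  c'.pc = o + e.len ∧ c'.reg d = e.eval c.mem ρ ∧ (∀ r < d, c'.reg r = c.reg r) ∧ c'.mem = c.mem

/-- The compiled expression does what it should. -/
def Exp.Correct (P : Program) (W B : ℕ) (e : Exp) : Prop :=
  ∀ {σ : ℕ → ℕ} {d o : ℕ} {ρ : ℕ → ℕ} {c : Config}, CodeAt P o (e.compile σ d o) → c.pc = o →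
    Holds σ d ρ c.reg → c.Bounded W → (∀ x, ρ x ≤ B) → (∀ k, c.mem k ≤ B) → B ^ e.deg ≤ W →
    Runs P W (e.cost ρ) (e.Post ρ d o c) c

/-- Two operands are evaluated into the registers `d` and `d + 1`. -/
theorem Exp.runs_pair {P : Program} {W B : ℕ} (hB : 2 ≤ B) {a b : Exp}
    (iha : a.Correct P W B) (ihb : b.Correct P W B)
    {σ : ℕ → ℕ} {d o : ℕ} {ρ : ℕ → ℕ} {c : Config} {l : List Instr}
    (hcode : CodeAt P o (a.compile σ d o ++ (b.compile σ (d + 1) (o + a.len) ++ l)))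
    (hpc : c.pc = o) (hσ : Holds σ d ρ c.reg) (hc : c.Bounded W) (hρ : ∀ x, ρ x ≤ B)
    (hm : ∀ k, c.mem k ≤ B) (hW : B ^ (a.deg + b.deg) ≤ W) :
    CodeAt P (o + a.len + b.len) l ∧
    Runs P W (a.cost ρ + b.cost ρ) (fun c' => c'.pc = o + a.len + b.len ∧
      c'.reg d = a.eval c.mem ρ ∧ c'.reg (d + 1) = b.eval c.mem ρ ∧
      (∀ r < d, c'.reg r = c.reg r) ∧ c'.mem = c.mem) c := by
  have hle : ∀ {i}, i ≤ a.deg + b.deg → B ^ i ≤ W := fun h =>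
    (Nat.pow_le_pow_right (by omega) h).trans hW
  rw [codeAt_append, codeAt_append, length_compile, length_compile] at hcode
  obtain ⟨ha, hb, hl⟩ := hcode
  refine ⟨hl, (iha ha hpc hσ hc hρ hm (hle (by omega))).trans fun c1 hc1 h1 => ?_⟩
  obtain ⟨p1, v1, r1, m1⟩ := h1
  refine (ihb hb p1 (hσ.congr (by omega) r1) hc1 hρ (by rwa [m1]) (hle (by omega))).mono le_rfl ?_
  rintro c2 ⟨p2, v2, r2, m2⟩
  refine ⟨p2, (r2 d (by omega)).trans v1, by rw [v2, m1], fun r hr => ?_, m2.trans m1⟩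
  exact (r2 r (by omega)).trans (r1 r hr)

/-- The proof is by induction on the expression; for searches, by induction on the rounds of
the loop. -/
theorem Exp.correct (P : Program) (W : ℕ) {B : ℕ} (hB : 2 ≤ B) (e : Exp) : e.Correct P W B := by
  have other : ∀ {d : ℕ} {f : ℕ → ℕ} {v : ℕ}, ∀ r < d, Function.update f d v r = f r :=
    fun {d f v} r hr => Function.update_of_ne (by omega) _ _
  induction e with
  | const k =>
    intro σ d o ρ c hcode hpc hσ hc hρ hm hW
    refine Runs.next hpc hcode.1 hc (Runs.done (hc.setReg ?_) ?_)
    · exact (eval_le_pow hB hm (const k) hρ).trans hW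
    · exact ⟨by simp [Instr.exec, Config.setReg, hpc, len], by simp [Instr.exec, Config.setReg, eval],
        other, rfl⟩
  | var x =>
    intro σ d o ρ c hcode hpc hσ hc hρ hm hW
    refine Runs.next hpc hcode.1 hc (Runs.done (hc.setReg (hc _).1) ?_)
    exact ⟨by simp [Instr.exec, Config.setReg, hpc, len],
      by simp [Instr.exec, Config.setReg, eval, (hσ x).2], other, rfl⟩
  | add a b iha ihb =>
    intro σ d o ρ c hcode hpc hσ hc hρ hm hW
    have hv := (eval_le_pow hB hm (add a b) hρ).trans hW
    obtain ⟨hl, h⟩ := runs_pair hB iha ihb hcode hpc hσ hc hρ hm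
      ((Nat.pow_le_pow_right (by omega) (by simp [deg])).trans hW)
    refine h.trans fun c1 hc1 ⟨p1, v1, w1, r1, m1⟩ => ?_
    refine Runs.next p1 hl.1 hc1 (Runs.done (hc1.setReg ?_) ?_)
    · rw [v1, w1]; exact hv
    · exact ⟨by simp [Instr.exec, Config.setReg, p1, len]; omega,
        by simp [Instr.exec, Config.setReg, eval, v1, w1], fun r hr => (other r hr).trans (r1 r hr),
        m1⟩
  | sub a b iha ihb =>
    intro σ d o ρ c hcode hpc hσ hc hρ hm hW
    have hv := (eval_le_pow hB hm (sub a b) hρ).trans hW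
    obtain ⟨hl, h⟩ := runs_pair hB iha ihb hcode hpc hσ hc hρ hm hW
    refine h.trans fun c1 hc1 ⟨p1, v1, w1, r1, m1⟩ => ?_
    refine Runs.next p1 hl.1 hc1 (Runs.done (hc1.setReg ?_) ?_)
    · rw [v1, w1]; exact hv
    · exact ⟨by simp [Instr.exec, Config.setReg, p1, len]; omega,
        by simp [Instr.exec, Config.setReg, eval, v1, w1], fun r hr => (other r hr).trans (r1 r hr),
        m1⟩
  | mul a b iha ihb =>
    intro σ d o ρ c hcode hpc hσ hc hρ hm hW
    have hv := (eval_le_pow hB hm (mul a b) hρ).trans hW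
    obtain ⟨hl, h⟩ := runs_pair hB iha ihb hcode hpc hσ hc hρ hm hW
    refine h.trans fun c1 hc1 ⟨p1, v1, w1, r1, m1⟩ => ?_
    refine Runs.next p1 hl.1 hc1 (Runs.done (hc1.setReg ?_) ?_)
    · rw [v1, w1]; exact hv
    · exact ⟨by simp [Instr.exec, Config.setReg, p1, len]; omega,
        by simp [Instr.exec, Config.setReg, eval, v1, w1], fun r hr => (other r hr).trans (r1 r hr),
        m1⟩
  | load a iha =>
    intro σ d o ρ c hcode hpc hσ hc hρ hm hW
    rw [compile, codeAt_append, length_compile] at hcode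
    refine (iha hcode.1 hpc hσ hc hρ hm
      ((Nat.pow_le_pow_right (by omega) (by simp [deg])).trans hW)).trans
      fun c1 hc1 ⟨p1, v1, r1, m1⟩ => ?_
    refine Runs.next p1 hcode.2.1 hc1 (Runs.done (hc1.setReg (hc1 _).2) ?_)
    exact ⟨by simp [Instr.exec, Config.setReg, p1, len]; omega,
      by simp [Instr.exec, Config.setReg, eval, v1, m1], fun r hr => (other r hr).trans (r1 r hr),
      m1⟩
  | search x N e ih =>
    intro σ d o ρ c hcode hpc hσ hc hρ hm hW
    have hBW : B ≤ W :=
      (Nat.pow_le_pow_right (by omega) (by simp [deg])).trans hW |>.trans' (by simp : B ≤ B ^ 1)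
    have hdeg : B ^ e.deg ≤ W := (Nat.pow_le_pow_right (by omega) (by simp [deg])).trans hW
    rw [compile, CodeAt, CodeAt, CodeAt, CodeAt, codeAt_append, length_compile] at hcode
    obtain ⟨i0, i1, i2, i3, hbody, i4, i5, i6, i7, i8, -⟩ := hcode
    set p : ℕ → Prop := fun k => e.eval c.mem (Function.update ρ x (k - 1)) ≠ 0 with hp
    -- `d` holds the result of the search among the values below the counter, which is in `d + 1`
    have inv : ∀ k ≤ ρ N, Runs P W
        ((∑ j ∈ Finset.range k, (e.cost (Function.update ρ x j) + 7)) + 2)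
        (fun c' => c'.pc = o + 2 ∧ c'.reg d = Nat.findGreatest p k ∧ c'.reg (d + 1) = k ∧
          (∀ r < d, c'.reg r = c.reg r) ∧ c'.mem = c.mem) c := by
      intro k
      induction k with
      | zero =>
        intro _
        have hc1 := hc.setReg (r := d) (Nat.zero_le W)
        refine Runs.next hpc i0 hc (Runs.next (c := c.setReg d 0) (by simp [Config.setReg, hpc]) i1 hc1
          (Runs.done (hc1.setReg (Nat.zero_le W)) ?_))
        · refine ⟨by simp [Instr.exec, Config.setReg, hpc],
            by simp [Instr.exec, Config.setReg],
            by simp [Instr.exec, Config.setReg], fun r hr => ?_, rfl⟩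
          have h1 : r ≠ d := by omega
          have h2 : r ≠ d + 1 := by omega
          simp [Instr.exec, Config.setReg, h1, h2]
      | succ k ihk =>
        intro hk
        rw [Finset.sum_range_succ]
        refine ((ihk (by omega)).trans (T' := e.cost (Function.update ρ x k) + 7)
          fun c1 hc1 ⟨p1, v1, w1, r1, m1⟩ => ?_).mono (by omega) (fun _ h => h)
        have hσN : c1.reg (σ N) = ρ N := (r1 _ (hσ N).1).trans (hσ N).2
        refine Runs.mono (T := (e.cost (Function.update ρ x k) + 5) + 1 + 1) ?_ (by omega)
          (fun _ h => h)
        -- the test does not leave the loop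
        have hc2 : (c1.setReg (d + 2) (ρ N - k)).Bounded W :=
          hc1.setReg ((Nat.sub_le _ _).trans ((hρ N).trans hBW))
        refine Runs.next p1 i2 hc1 ?_
        have e1 : (Instr.sub (d + 2) (σ N) (d + 1)).exec c1 = c1.setReg (d + 2) (ρ N - k) := by
          simp [Instr.exec, hσN, w1]
        rw [e1]
        refine Runs.next (by simp [Config.setReg, p1]) i3 hc2 ?_
        set c3 := (Instr.jumpZero (d + 2) (o + e.len + 9)).exec (c1.setReg (d + 2) (ρ N - k))
          with hc3def
        have p3 : c3.pc = o + 4 := by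
          have : ρ N - k ≠ 0 := by omega
          simp [hc3def, Instr.exec, Config.setReg, this, p1]
        have hc3 : c3.Bounded W := hc2
        have r3 : ∀ r < d + 2, c3.reg r = c1.reg r := fun r hr => other r hr
        have m3 : c3.mem = c.mem := m1
        have body := ih (σ := Function.update σ x (d + 1)) (d := d + 2) (o := o + 4)
          (ρ := Function.update ρ x k) (c := c3)
          hbody p3 (hσ.update (by omega) (by omega)
            (fun r hr => (r3 r (by omega)).trans (r1 r hr)) ((r3 _ (by omega)).trans w1)) hc3
          (fun y => by
            by_cases hy : y = x
            · subst hy; simpa using (show k ≤ B from (by omega : k ≤ ρ N).trans (hρ N))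
            · simpa [hy] using hρ y) (by rwa [m3]) hdeg
        refine body.trans fun c4 hc4 ⟨p4, v4, r4, m4⟩ => ?_
        -- the counter is increased
        have p4' : c4.pc = o + 1 + 1 + 1 + 1 + e.len := by omega
        refine Runs.next p4' i4 hc4 ?_
        have hc5 : (c4.setReg (d + 3) 1).Bounded W := hc4.setReg (by omega)
        refine Runs.next (c := c4.setReg (d + 3) 1) (by simp [Config.setReg, p4']) i5 hc5 ?_
        set c6 := (Instr.add (d + 1) (d + 1) (d + 3)).exec (c4.setReg (d + 3) 1) with hc6def
        have w4 : c4.reg (d + 1) = k := by rw [r4 _ (by omega), r3 _ (by omega), w1]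
        have e6 : c6 = (c4.setReg (d + 3) 1).setReg (d + 1) (k + 1) := by
          simp [hc6def, Instr.exec, Config.setReg, w4]
        have hc6 : c6.Bounded W := e6 ▸ hc5.setReg (hk.trans ((hρ N).trans hBW))
        have p6 : c6.pc = o + 1 + 1 + 1 + 1 + e.len + 1 + 1 := by
          simp [e6, Config.setReg, p4']
        have w6 : c6.reg (d + 1) = k + 1 := by simp [e6, Config.setReg]
        have u6 : c6.reg (d + 2) = e.eval c.mem (Function.update ρ x k) := by
          have : c6.reg (d + 2) = c4.reg (d + 2) := by simp [e6, Config.setReg]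
          rw [this, v4, m3]
        have r6 : ∀ r < d + 1, c6.reg r = c1.reg r := by
          intro r hr
          have h1 : r ≠ d + 1 := by omega
          have h2 : r ≠ d + 3 := by omega
          have : c6.reg r = c4.reg r := by simp [e6, Config.setReg, h1, h2]
          rw [this, r4 _ (by omega), r3 _ (by omega)]
        have m6 : c6.mem = c.mem := by rw [e6]; exact m4.trans m3
        refine Runs.next p6 i6 hc6 ?_
        by_cases hz : e.eval c.mem (Function.update ρ x k) = 0
        · refine Runs.done hc6 ?_
          refine ⟨by simp [Instr.exec, u6, hz], ?_, w6,
            fun r hr => (r6 r (by omega)).trans (r1 r hr), m6⟩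
          have : ¬ p (k + 1) := by simpa [hp] using hz
          rw [Nat.findGreatest_of_not this, ← v1]
          exact r6 d (by omega)
        · set c7 := (Instr.jumpZero (d + 2) (o + 2)).exec c6 with hc7def
          have p7 : c7.pc = o + 1 + 1 + 1 + 1 + e.len + 1 + 1 + 1 := by
            simp [hc7def, Instr.exec, u6, hz, p6]
          have hc7 : c7.Bounded W := hc6
          have w7 : c7.reg (d + 1) = k + 1 := w6
          refine Runs.next p7 i7 hc7 ?_
          have hc8 : (c7.setReg d (k + 1)).Bounded W :=
            hc7.setReg (hk.trans ((hρ N).trans hBW))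
          have e8 : (Instr.copy d (d + 1)).exec c7 = c7.setReg d (k + 1) := by
            simp [Instr.exec, w7]
          rw [e8]
          refine Runs.next (by simp [Config.setReg, p7]) i8 hc8 (Runs.done hc8 ?_)
          have : p (k + 1) := by simpa [hp] using hz
          refine ⟨rfl, ?_, ?_, fun r hr => ?_, m6⟩
          · rw [Nat.findGreatest_eq this]; simp [Instr.exec, Config.setReg]
          · simpa [Instr.exec, Config.setReg] using w7
          · have h1 : r ≠ d := by omega
            have : c7.reg r = c.reg r := (r6 r (by omega)).trans (r1 r hr)
            simpa [Instr.exec, Config.setReg, h1] using this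
    refine ((inv _ le_rfl).trans (T' := 2) fun c1 hc1 ⟨p1, v1, w1, r1, m1⟩ => ?_).mono
      (by simp [cost]) (fun _ h => h)
    have hσN : c1.reg (σ N) = ρ N := (r1 _ (hσ N).1).trans (hσ N).2
    have hc2 : (c1.setReg (d + 2) 0).Bounded W := hc1.setReg (Nat.zero_le _)
    refine Runs.next p1 i2 hc1 ?_
    have e1 : (Instr.sub (d + 2) (σ N) (d + 1)).exec c1 = c1.setReg (d + 2) 0 := by
      simp [Instr.exec, hσN, w1]
    rw [e1]
    refine Runs.next (by simp [Config.setReg, p1]) i3 hc2 (Runs.done hc2 ?_)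
    refine ⟨by simp [Instr.exec, Config.setReg, len]; omega, ?_, fun r hr => ?_, m1⟩
    · simp [Instr.exec, Config.setReg, v1, eval, hp]
    · have h1 : r ≠ d + 2 := by omega
      simp [Instr.exec, Config.setReg, h1, r1 r hr]

/-- Safe commands keep the memory cells small. -/
theorem Cmd.exec_le {B : ℕ} (hB : 2 ≤ B) (c : Cmd) : ∀ {ρ mem : ℕ → ℕ}, c.Safe B ρ mem →
    (∀ x, ρ x ≤ B) → (∀ k, mem k ≤ B) → ∀ k, c.exec ρ mem k ≤ B := by
  induction c with
  | store a e =>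
    intro ρ mem hs hρ hm k
    rw [exec, Function.update_apply]
    split_ifs
    · exact e.eval_le_of_small hB hm hs hρ
    · exact hm k
  | seq c c' ih ih' => exact fun hs hρ hm => ih' hs.2 hρ (ih hs.1 hρ hm)
  | loop x N c ih =>
    intro ρ mem hs hρ hm
    rw [exec_loop]
    have : ∀ k ≤ ρ N, ∀ j, c.iter x ρ mem k j ≤ B := by
      intro k
      induction k with
      | zero => exact fun _ => hm
      | succ k ihk =>
        intro hk
        refine ih (hs k hk) (fun y => ?_) (ihk (by omega))
        rw [Function.update_apply]
        split_ifs
        · exact (by omega : k ≤ ρ N).trans (hρ N)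
        · exact hρ y
    exact this _ le_rfl
  | bind x e c ih =>
    intro ρ mem hs hρ hm
    refine ih hs.2 (fun y => ?_) hm
    rw [Function.update_apply]
    split_ifs
    · exact hs.1
    · exact hρ y

theorem Cmd.correct (P : Program) (W : ℕ) {B : ℕ} (hB : 2 ≤ B) (b : Cmd) :
    ∀ {σ : ℕ → ℕ} {d o : ℕ} {ρ : ℕ → ℕ} {c : Config}, CodeAt P o (b.compile σ d o) → c.pc = o →
      Holds σ d ρ c.reg → c.Bounded W → (∀ x, ρ x ≤ B) → (∀ k, c.mem k ≤ B) → B ^ b.deg ≤ W →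
      b.Safe B ρ c.mem →
      Runs P W (b.cost ρ c.mem) (fun c' => c'.pc = o + b.len ∧ (∀ r < d, c'.reg r = c.reg r) ∧
        c'.mem = b.exec ρ c.mem) c := by
  induction b with
  | store a e =>
    intro σ d o ρ c hcode hpc hσ hc hρ hm hW hs
    obtain ⟨hl, h⟩ := Exp.runs_pair hB (a.correct P W hB) (e.correct P W hB) hcode hpc hσ hc hρ hm hW
    refine h.trans fun c1 hc1 ⟨p1, v1, w1, r1, m1⟩ => ?_
    refine Runs.next p1 hl.1 hc1 (Runs.done ?_ ?_)
    · intro k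
      refine ⟨(hc1 k).1, ?_⟩
      simp only [Instr.exec, Function.update_apply]
      split_ifs
      · exact (hc1 _).1
      · exact (hc1 k).2
    · exact ⟨by simp [Instr.exec, p1, len]; omega, r1, by simp [Instr.exec, exec, v1, w1, m1]⟩
  | seq b b' ih ih' =>
    intro σ d o ρ c hcode hpc hσ hc hρ hm hW hs
    rw [compile, codeAt_append, length_compile] at hcode
    have hle : ∀ {i}, i ≤ b.deg + b'.deg → B ^ i ≤ W := fun h =>
      (Nat.pow_le_pow_right (by omega) h).trans hW
    refine (ih hcode.1 hpc hσ hc hρ hm (hle (by omega)) hs.1).trans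
      fun c1 hc1 ⟨p1, r1, m1⟩ => ?_
    have := ih' hcode.2 p1 (hσ.congr le_rfl r1) hc1 hρ
      (by rw [m1]; exact b.exec_le hB hs.1 hρ hm) (hle (by omega)) (by rw [m1]; exact hs.2)
    rw [m1] at this
    refine this.mono le_rfl ?_
    rintro c2 ⟨p2, r2, m2⟩
    exact ⟨by rw [p2, len]; omega, fun r hr => (r2 r hr).trans (r1 r hr), m2⟩
  | loop x N b ih =>
    intro σ d o ρ c hcode hpc hσ hc hρ hm hW hs
    have hBW : B ≤ W :=
      (Nat.pow_le_pow_right (by omega) (by simp [deg])).trans hW |>.trans' (by simp : B ≤ B ^ 1)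
    have hdeg : B ^ b.deg ≤ W := (Nat.pow_le_pow_right (by omega) (by simp [deg])).trans hW
    rw [compile, CodeAt, CodeAt, CodeAt, codeAt_append, length_compile] at hcode
    obtain ⟨i0, i1, i2, hbody, i3, i4, i5, -⟩ := hcode
    have inv : ∀ k ≤ ρ N, (∀ j, b.iter x ρ c.mem k j ≤ B) ∧ Runs P W
        ((∑ j ∈ Finset.range k, (b.cost (Function.update ρ x j) (b.iter x ρ c.mem j) + 5)) + 1)
        (fun c' => c'.pc = o + 1 ∧ c'.reg d = k ∧
          (∀ r < d, c'.reg r = c.reg r) ∧ c'.mem = b.iter x ρ c.mem k) c := by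
      intro k
      induction k with
      | zero =>
        refine fun _ => ⟨hm, Runs.next hpc i0 hc (Runs.done (hc.setReg (Nat.zero_le W)) ?_)⟩
        refine ⟨by simp [Instr.exec, Config.setReg, hpc],
            by simp [Instr.exec, Config.setReg], fun r hr => ?_, rfl⟩
        have h1 : r ≠ d := by omega
        simp [Instr.exec, Config.setReg, h1]
      | succ k ihk =>
        intro hk
        obtain ⟨hmk, hrun⟩ := ihk (by omega)
        have hρ' : ∀ y, Function.update ρ x k y ≤ B := fun y => by
          by_cases hy : y = x
          · subst hy; simpa using (show k ≤ B from (by omega : k ≤ ρ N).trans (hρ N))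
          · simpa [hy] using hρ y
        refine ⟨b.exec_le hB (hs k hk) hρ' hmk, ?_⟩
        rw [Finset.sum_range_succ]
        refine (hrun.trans
          (T' := b.cost (Function.update ρ x k) (b.iter x ρ c.mem k) + 5)
          fun c1 hc1 ⟨p1, v1, r1, m1⟩ => ?_).mono (by omega) (fun _ h => h)
        have hσN : c1.reg (σ N) = ρ N := (r1 _ (hσ N).1).trans (hσ N).2
        have hc2 : (c1.setReg (d + 1) (ρ N - k)).Bounded W :=
          hc1.setReg ((Nat.sub_le _ _).trans ((hρ N).trans hBW))
        refine Runs.mono (T := b.cost (Function.update ρ x k) (b.iter x ρ c.mem k) + 3 + 1 + 1) ?_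
          (by omega) (fun _ h => h)
        refine Runs.next p1 i1 hc1 ?_
        have e1 : (Instr.sub (d + 1) (σ N) d).exec c1 = c1.setReg (d + 1) (ρ N - k) := by
          simp [Instr.exec, hσN, v1]
        rw [e1]
        refine Runs.next (by simp [Config.setReg, p1]) i2 hc2 ?_
        set c3 := (Instr.jumpZero (d + 1) (o + b.len + 6)).exec (c1.setReg (d + 1) (ρ N - k))
          with hc3def
        have p3 : c3.pc = o + 3 := by
          have : ρ N - k ≠ 0 := by omega
          simp [hc3def, Instr.exec, Config.setReg, this, p1]
        have hc3 : c3.Bounded W := hc2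
        have r3 : ∀ r < d + 1, c3.reg r = c1.reg r := fun r hr =>
          Function.update_of_ne (by omega) _ _
        have m3 : c3.mem = b.iter x ρ c.mem k := m1
        have body := ih (σ := Function.update σ x d) (d := d + 1) (o := o + 3)
          (ρ := Function.update ρ x k) (c := c3)
          hbody p3 (hσ.update le_rfl (by omega)
            (fun r hr => (r3 r (by omega)).trans (r1 r hr)) ((r3 _ (by omega)).trans v1)) hc3
          hρ' (by rwa [m3]) hdeg (by rw [m3]; exact hs k hk)
        rw [m3] at body
        refine body.trans fun c4 hc4 ⟨p4, r4, m4⟩ => ?_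
        have p4' : c4.pc = o + 1 + 1 + 1 + b.len := by omega
        refine Runs.next p4' i3 hc4 ?_
        have hc5 : (c4.setReg (d + 1) 1).Bounded W := hc4.setReg (by omega)
        refine Runs.next (c := c4.setReg (d + 1) 1) (by simp [Config.setReg, p4']) i4 hc5 ?_
        have v4 : c4.reg d = k := by rw [r4 _ (by omega), r3 _ (by omega), v1]
        have e6 : (Instr.add d d (d + 1)).exec (c4.setReg (d + 1) 1) =
            (c4.setReg (d + 1) 1).setReg d (k + 1) := by
          simp [Instr.exec, Config.setReg, v4]
        rw [e6]
        have hc6 := hc5.setReg (r := d) (hk.trans ((hρ N).trans hBW))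
        refine Runs.next (by simp [Config.setReg, p4']) i5 hc6 (Runs.done hc6 ?_)
        refine ⟨rfl, by simp [Instr.exec, Config.setReg], fun r hr => ?_, m4⟩
        have h1 : r ≠ d := by omega
        have h2 : r ≠ d + 1 := by omega
        have : c4.reg r = c.reg r := by rw [r4 _ (by omega), r3 _ (by omega), r1 r hr]
        simp [Instr.exec, Config.setReg, h1, h2, this]
    refine ((inv _ le_rfl).2.trans (T' := 2) fun c1 hc1 ⟨p1, v1, r1, m1⟩ => ?_).mono
      (by simp [cost]) (fun _ h => h)
    have hσN : c1.reg (σ N) = ρ N := (r1 _ (hσ N).1).trans (hσ N).2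
    have hc2 : (c1.setReg (d + 1) 0).Bounded W := hc1.setReg (Nat.zero_le _)
    refine Runs.next p1 i1 hc1 ?_
    have e1 : (Instr.sub (d + 1) (σ N) d).exec c1 = c1.setReg (d + 1) 0 := by
      simp [Instr.exec, hσN, v1]
    rw [e1]
    refine Runs.next (by simp [Config.setReg, p1]) i2 hc2 (Runs.done hc2 ?_)
    refine ⟨by simp [Instr.exec, Config.setReg, len]; omega, fun r hr => ?_, m1⟩
    have h1 : r ≠ d + 1 := by omega
    simp [Instr.exec, Config.setReg, h1, r1 r hr]
  | bind x e b ih =>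
    intro σ d o ρ c hcode hpc hσ hc hρ hm hW hs
    rw [compile, codeAt_append, Exp.length_compile] at hcode
    have hle : ∀ {i}, i ≤ e.deg + b.deg → B ^ i ≤ W := fun h =>
      (Nat.pow_le_pow_right (by omega) h).trans hW
    refine (e.correct P W hB hcode.1 hpc hσ hc hρ hm (hle (by omega))).trans
      fun c1 hc1 ⟨p1, v1, r1, m1⟩ => ?_
    have := ih hcode.2 p1 (hσ.update le_rfl (Nat.lt_succ_self d) r1 v1) hc1
      (fun y => by
        rw [Function.update_apply]
        split_ifs
        · exact hs.1
        · exact hρ y) (by rwa [m1]) (hle (by omega)) (by rw [m1]; exact hs.2)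
    rw [m1] at this
    refine this.mono le_rfl ?_
    rintro c2 ⟨p2, r2, m2⟩
    exact ⟨by rw [p2, len]; omega, fun r hr => (r2 r (by omega)).trans (r1 r hr), m2⟩

/-- The program that executes a command and returns the content of memory cell `0`. -/
def Cmd.program (b : Cmd) : Program :=
  b.compile (fun _ => 0) 1 0 ++ [.load 0 0]

theorem Cmd.program_correct {B : ℕ} (hB : 2 ≤ B) (b : Cmd) {w : List ℕ} (hw : ∀ k, w.getD k 0 ≤ B)
    (hs : b.Safe B (fun _ => 0) fun k => w.getD k 0) :
    ∃ t ≤ b.cost (fun _ => 0) (fun k => w.getD k 0) + 1,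
      b.program.length ≤ (run b.program w t).pc ∧
      (run b.program w t).reg 0 = b.exec (fun _ => 0) (fun k => w.getD k 0) 0 ∧
      ∀ s ≤ t, (run b.program w s).Bounded (B ^ (b.deg + 1)) := by
  have hcode := codeAt_self b.program
  rw [program, codeAt_append, length_compile] at hcode
  have hBW : B ≤ B ^ (b.deg + 1) := Nat.le_self_pow (by omega) B
  have hb : (init w).Bounded (B ^ (b.deg + 1)) := fun k => ⟨Nat.zero_le _, (hw k).trans hBW⟩
  have h := (b.correct b.program (B ^ (b.deg + 1)) hB (c := init w) (ρ := fun _ => 0) hcode.1 rfl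
    (fun x => ⟨Nat.one_pos, rfl⟩) hb (fun _ => Nat.zero_le _) hw
    (Nat.pow_le_pow_right (by omega) (by omega)) hs).trans (T' := 1)
    (Q' := fun c' => b.program.length ≤ c'.pc ∧
      c'.reg 0 = b.exec (fun _ => 0) (fun k => w.getD k 0) 0) fun c1 hc1 ⟨p1, r1, m1⟩ => by
      refine Runs.next p1 hcode.2.1 hc1 (Runs.done (hc1.setReg (hc1 _).2) ?_)
      have h0 : c1.reg 0 = 0 := r1 0 Nat.one_pos
      refine ⟨by simp [Instr.exec, Config.setReg, p1, program], ?_⟩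
      simp [Instr.exec, Config.setReg, h0, m1, init]
  obtain ⟨t, ht, hQ, hbd⟩ := h
  exact ⟨t, ht, hQ.1, hQ.2, hbd⟩

end RAM

/-! ### A Helly property of single-peaked votes -/

section Helly

variable {C : Type*}

/-- A vote, given by its positions `w`, ranks the candidate `b` below both `a` and `c`. -/
def RanksLast (w : C → ℕ) (b a c : C) : Prop :=
  w a < w b ∧ w c < w b

/-- The votes `u₁, u₂, u₃` are worst-diverse: there are three candidates such that each of the votes
ranks another one of them last. -/
def WorstDiverse (u₁ u₂ u₃ : C → ℕ) : Prop :=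
  ∃ a b c, RanksLast u₁ a b c ∧ RanksLast u₂ b a c ∧ RanksLast u₃ c a b

/-- The votes `u, u'` rank three candidates `a, b, c` in opposite ways, `b` being in the middle, and
both of them rank a fourth candidate `d` above `b`. -/
def Opposed (u u' : C → ℕ) : Prop :=
  ∃ a b c d, u a < u b ∧ u b < u c ∧ u d < u b ∧ u' c < u' b ∧ u' b < u' a ∧ u' d < u' b

/-- The axis is given by a function `f` into the integers: from left to right, `f` increases.
Candidates with the same value of `f` are not yet ordered. No vote ranks a candidate below
candidates on both sides. -/
def PeakedAlong (S : Set (C → ℕ)) (f : C → ℤ) : Prop :=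
  ∀ w ∈ S, ∀ a b c, f a < f b → f b < f c → ¬ RanksLast w b a c

/-- A single-peaked axis rules out worst-diverse triples of votes. -/
theorem PeakedAlong.not_worstDiverse {S : Set (C → ℕ)} {f : C → ℤ} (hf : f.Injective)
    (h : PeakedAlong S f) {u₁ u₂ u₃ : C → ℕ} (h₁ : u₁ ∈ S) (h₂ : u₂ ∈ S) (h₃ : u₃ ∈ S) :
    ¬ WorstDiverse u₁ u₂ u₃ := by
  rintro ⟨a, b, c, ha, hb, hc⟩
  have ne : ∀ {x y : C} {u : C → ℕ}, u x < u y → f x ≠ f y := fun hu e => by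
    rw [hf e] at hu; exact lt_irrefl _ hu
  have ha' := h u₁ h₁
  have hb' := h u₂ h₂
  have hc' := h u₃ h₃
  have h1 := ne ha.1
  have h2 := ne ha.2
  have h3 := ne hb.2
  have h4 := fun x y => ha' b a c x y ha
  have h5 := fun x y => ha' c a b x y ha.symm
  have h6 := fun x y => hb' a b c x y hb
  have h7 := fun x y => hb' c b a x y hb.symm
  have h8 := fun x y => hc' a c b x y hc
  have h9 := fun x y => hc' b c a x y hc.symm
  grind

/-- A single-peaked axis rules out opposed votes. -/
theorem PeakedAlong.not_opposed {S : Set (C → ℕ)} {f : C → ℤ} (hf : f.Injective)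
    (h : PeakedAlong S f) {u u' : C → ℕ} (hu : u ∈ S) (hu' : u' ∈ S) : ¬ Opposed u u' := by
  rintro ⟨a, b, c, d, h1, h2, h3, h4, h5, h6⟩
  have ne : ∀ {x y : C} {u : C → ℕ}, u x < u y → f x ≠ f y := fun hu e => by
    rw [hf e] at hu; exact lt_irrefl _ hu
  have e1 := ne h1
  have e2 := ne h2
  have e3 := ne h3
  have e4 := ne (h1.trans h2)
  have c1 := fun x y => h u hu a c b x y ⟨h1.trans h2, h2⟩
  have c2 := fun x y => h u hu b c a x y ⟨h2, h1.trans h2⟩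
  have c3 := fun x y => h u' hu' c a b x y ⟨h4.trans h5, h5⟩
  have c4 := fun x y => h u' hu' b a c x y ⟨h5, h4.trans h5⟩
  have c5 := fun x y => h u hu a b d x y ⟨h1, h3⟩
  have c6 := fun x y => h u hu d b a x y ⟨h3, h1⟩
  have c7 := fun x y => h u' hu' c b d x y ⟨h4, h6⟩
  have c8 := fun x y => h u' hu' d b c x y ⟨h6, h4⟩
  grind

variable {S : Set (C → ℕ)}

/-- A partial axis: the candidates with `f p < 0` have been placed at the left end, those with
`0 < f p` at the right end, and those with `f p = 0` are still to be placed between them. Every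
placed candidate has been ranked below all unplaced ones by some vote. The last condition leaves
room for the next candidates at both sides of the gap. -/
structure PartialAxis [Fintype C] (S : Set (C → ℕ)) (f : C → ℤ) : Prop where
  inj : ∀ a b, f a = f b → a = b ∨ f a = 0
  peaked : PeakedAlong S f
  witness : ∀ p, f p ≠ 0 → ∃ u ∈ S, ∀ c, f c = 0 → u c < u p
  room : ∀ p, f p ≠ 0 → ((Finset.univ.filter fun c => f c = 0).card : ℤ) < |f p|

theorem PartialAxis.neg [Fintype C] {f : C → ℤ} (h : PartialAxis S f) : PartialAxis S (-f) where
  inj a b hab := by simpa using h.inj a b (by simpa using hab)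
  peaked w hw a b c h1 h2 hr :=
    h.peaked w hw c b a (by simpa using h2) (by simpa using h1) hr.symm
  witness p hp := by simpa using h.witness p (by simpa using hp)
  room p hp := by simpa using h.room p (by simpa using hp)

/-- An unplaced candidate `x` that some vote ranks last among the unplaced ones. -/
def LastUnplaced (f : C → ℤ) (w : C → ℕ) (x : C) : Prop :=
  f x = 0 ∧ ∀ c, f c = 0 → c ≠ x → w c < w x

/-- No vote that ranks `x` last among the unplaced candidates ranks a candidate on the left of them
above `x`. -/
def LeftFree (S : Set (C → ℕ)) (f : C → ℤ) (x : C) : Prop :=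
  ∀ w ∈ S, LastUnplaced f w x → ∀ l, f l < 0 → w x < w l

theorem lastUnplaced_neg {f : C → ℤ} {w : C → ℕ} {x : C} :
    LastUnplaced (-f) w x ↔ LastUnplaced f w x := by
  simp [LastUnplaced]

namespace PartialAxis

variable {f : C → ℤ}

theorem exists_last [Fintype C] (hinj : ∀ w ∈ S, w.Injective) {w : C → ℕ} (hw : w ∈ S) {x : C}
    (hx : f x = 0) :
    ∃ y, LastUnplaced f w y := by
  obtain ⟨y, hy, hmax⟩ := Finset.exists_max_image (Finset.univ.filter fun c => f c = 0) w
    ⟨x, by simpa using hx⟩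
  refine ⟨y, by simpa using hy, fun c hc hcy => ?_⟩
  exact lt_of_le_of_ne (hmax c (by simpa using hc)) fun e => hcy (hinj w hw e)

/-- The candidate `x` can be placed at the left of the gap if this puts no candidate between two
candidates that some vote ranks above it. -/
theorem place_left [Fintype C] (h : PartialAxis S f) {x : C} (hx : f x = 0)
    (hleft : ∀ w ∈ S, ∀ l, f l < 0 → ∀ c, f c = 0 → ¬ RanksLast w x l c)
    (hright : ∀ w ∈ S, ∀ r, 0 < f r → ∀ c, f c = 0 → ¬ RanksLast w c x r)
    (hlast : ∃ u ∈ S, LastUnplaced f u x) :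
    ∃ g, PartialAxis S g ∧ g x < 0 ∧ ∀ p, p ≠ x → g p = f p := by
  classical
  set M := Finset.univ.filter fun c => f c = 0 with hM
  have hxM : x ∈ M := by simpa [hM] using hx
  have hpos : 0 < M.card := Finset.card_pos.2 ⟨x, hxM⟩
  set g : C → ℤ := Function.update f x (-(M.card : ℤ)) with hg
  have gx : g x = -(M.card : ℤ) := by simp [hg]
  have gp : ∀ p, p ≠ x → g p = f p := fun p hp => by simp [hg, hp]
  have room0 : ∀ p, f p ≠ 0 → (M.card : ℤ) < |f p| := h.room
  have room : ∀ p, f p ≠ 0 → f p < -(M.card : ℤ) ∨ (M.card : ℤ) < f p := fun p hp => by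
    have := room0 p hp
    rcases abs_cases (f p) with h' | h' <;> omega
  have hM' : (Finset.univ.filter fun c => g c = 0) = M.erase x := by
    ext c
    by_cases hc : c = x
    · subst hc
      have : g c ≠ 0 := by omega
      simp [this]
    · simp [hM, gp c hc, hc]
  refine ⟨g, ⟨fun a b hab => ?_, fun w hw a b c h1 h2 hr => ?_, fun p hp => ?_, fun p hp => ?_⟩,
    by omega, gp⟩
  · by_cases ha : a = x <;> by_cases hb : b = x
    · exact Or.inl (ha.trans hb.symm)
    · subst ha
      rw [gx, gp b hb] at hab
      have := room b (by omega)
      omega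
    · subst hb
      rw [gx, gp a ha] at hab
      have := room a (by omega)
      omega
    · rw [gp a ha, gp b hb] at hab
      rw [gp a ha]
      exact h.inj a b hab
  · have hab : a ≠ b := by rintro rfl; omega
    have hbc : b ≠ c := by rintro rfl; omega
    have hac : a ≠ c := by rintro rfl; omega
    by_cases ha : a = x
    · subst ha
      rw [gx, gp b hab.symm] at h1
      rw [gp b hab.symm, gp c hac.symm] at h2
      by_cases hb : f b = 0
      · exact hright w hw c (by omega) b hb hr
      · have := room b hb
        exact h.peaked w hw a b c (by omega) h2 hr
    · by_cases hb : b = x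
      · subst hb
        rw [gx, gp a ha] at h1
        rw [gx, gp c hbc.symm] at h2
        by_cases hc : f c = 0
        · exact hleft w hw a (by omega) c hc hr
        · have := room c hc
          exact h.peaked w hw a b c (by omega) (by omega) hr
      · rw [gp a ha, gp b hb] at h1
        rw [gp b hb] at h2
        by_cases hc : c = x
        · subst hc
          exact h.peaked w hw a b c (by omega) (by omega) hr
        · rw [gp c hc] at h2
          exact h.peaked w hw a b c h1 h2 hr
  · by_cases hpx : p = x
    · subst hpx
      obtain ⟨u, hu, -, hlt⟩ := hlast
      refine ⟨u, hu, fun c hc => ?_⟩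
      have hcp : c ≠ p := by rintro rfl; omega
      exact hlt c (by rwa [gp c hcp] at hc) hcp
    · obtain ⟨u, hu, hlt⟩ := h.witness p (by rwa [gp p hpx] at hp)
      refine ⟨u, hu, fun c hc => hlt c ?_⟩
      have hcx : c ≠ x := by rintro rfl; omega
      rwa [gp c hcx] at hc
  · rw [hM', Finset.card_erase_of_mem hxM]
    by_cases hpx : p = x
    · subst hpx
      rw [gx, abs_neg, Nat.abs_cast]
      omega
    · rw [gp p hpx] at hp ⊢
      have := room0 p hp
      omega

theorem place_right [Fintype C] (h : PartialAxis S f) {x : C} (hx : f x = 0)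
    (hright : ∀ w ∈ S, ∀ r, 0 < f r → ∀ c, f c = 0 → ¬ RanksLast w x r c)
    (hleft : ∀ w ∈ S, ∀ l, f l < 0 → ∀ c, f c = 0 → ¬ RanksLast w c x l)
    (hlast : ∃ u ∈ S, LastUnplaced f u x) :
    ∃ g, PartialAxis S g ∧ 0 < g x ∧ ∀ p, p ≠ x → g p = f p := by
  obtain ⟨g, hg, hgx, hgp⟩ := h.neg.place_left (x := x) (by simpa using hx)
    (fun w hw r hr c hc => hright w hw r (by simpa using hr) c (by simpa using hc))
    (fun w hw l hl c hc => hleft w hw l (by simpa using hl) c (by simpa using hc))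
    (by simpa only [lastUnplaced_neg] using hlast)
  exact ⟨-g, hg.neg, by simpa using hgx, fun p hp => by simp [hgp p hp]⟩

theorem ne_of_placed (hinj : ∀ w ∈ S, w.Injective) {w : C → ℕ} (hw : w ∈ S) {p x : C}
    (hp : f p ≠ 0) (hx : f x = 0) : w p ≠ w x := fun e => by
  rw [hinj w hw e] at hp; exact hp hx

/-- A candidate is free on at least one side: otherwise two votes would be opposed. -/
theorem leftFree_or [Fintype C] (h : PartialAxis S f) (hinj : ∀ w ∈ S, w.Injective)
    (hop : ∀ u ∈ S, ∀ u' ∈ S, ¬ Opposed u u') {x d : C} (hd : f d = 0) (hdx : d ≠ x) :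
    LeftFree S f x ∨ LeftFree S (-f) x := by
  by_contra! hcon
  simp only [LeftFree, lastUnplaced_neg, Pi.neg_apply] at hcon
  push Not at hcon
  obtain ⟨⟨w, hw, hwx, l, hl, hlx⟩, w', hw', hwx', r, hr, hrx⟩ := hcon
  have hx := hwx.1
  have h1 : w l < w x := lt_of_le_of_ne hlx (ne_of_placed hinj hw (by omega) hx)
  have h2 : w' r < w' x := lt_of_le_of_ne hrx (ne_of_placed hinj hw' (by omega) hx)
  have n1 := h.peaked w hw l x r (by omega) (by omega)
  have n2 := h.peaked w' hw' l x r (by omega) (by omega)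
  have n3 := ne_of_placed hinj hw (show f r ≠ 0 by omega) hx
  have n4 := ne_of_placed hinj hw' (show f l ≠ 0 by omega) hx
  unfold RanksLast at n1 n2
  exact hop w hw w' hw' ⟨l, x, r, d, h1, by omega, hwx.2 d hd hdx, h2, by omega, hwx'.2 d hd hdx⟩

/-- Of two candidates, at least one is free on the left: otherwise three votes would be
worst-diverse, or one of the candidates on the left would not be placed correctly. -/
theorem leftFree_or_leftFree [Fintype C] (h : PartialAxis S f) (hinj : ∀ w ∈ S, w.Injective)
    (hwd : ∀ u₁ ∈ S, ∀ u₂ ∈ S, ∀ u₃ ∈ S, ¬ WorstDiverse u₁ u₂ u₃) {x y : C} (hxy : x ≠ y) :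
    LeftFree S f x ∨ LeftFree S f y := by
  by_contra! hcon
  simp only [LeftFree] at hcon
  push Not at hcon
  obtain ⟨⟨w, hw, hwx, l, hl, hlx⟩, w', hw', hwy, l', hl', hly⟩ := hcon
  have hx := hwx.1
  have hy := hwy.1
  have h1 : w l < w x := lt_of_le_of_ne hlx (ne_of_placed hinj hw (by omega) hx)
  have h2 : w' l' < w' y := lt_of_le_of_ne hly (ne_of_placed hinj hw' (by omega) hy)
  have h3 := hwx.2 y hy hxy.symm
  have h4 := hwy.2 x hx hxy
  have wd : ∀ l, f l < 0 → w l < w x → w' l < w' y → False := fun l hl h5 h6 => by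
    obtain ⟨u, hu, hlt⟩ := h.witness l (by omega)
    exact hwd w hw w' hw' u hu ⟨x, y, l, ⟨h3, h5⟩, ⟨h4, h6⟩, hlt x hx, hlt y hy⟩
  have h5 := not_lt.1 (wd l hl h1)
  have h6 := not_lt.1 fun h6 => wd l' hl' h6 h2
  have hne : f l ≠ f l' := fun e => by
    rcases h.inj l l' e with rfl | e
    · omega
    · omega
  have n1 := ne_of_placed hinj hw (show f l' ≠ 0 by omega) hx
  have n2 := ne_of_placed hinj hw' (show f l ≠ 0 by omega) hy
  rcases lt_or_gt_of_ne hne with hlt | hlt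
  · exact h.peaked w hw l l' x hlt (by omega) ⟨by omega, by omega⟩
  · exact h.peaked w' hw' l' l x hlt (by omega) ⟨by omega, by omega⟩

/-- If `x` is free on the left, and each vote ranks `x` or `y` last, then `x` can be placed next to
the candidates on the left. -/
theorem not_ranksLast_of_leftFree (hop : ∀ u ∈ S, ∀ u' ∈ S, ¬ Opposed u u') {x y : C}
    (hxy : x ≠ y) (hx : ∃ u ∈ S, LastUnplaced f u x) (hy : f y = 0)
    (hlast : ∀ w ∈ S, LastUnplaced f w x ∨ LastUnplaced f w y) (hfree : LeftFree S f x)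
    {w : C → ℕ} (hw : w ∈ S) {l : C} (hl : f l < 0) {c : C} (hc : f c = 0) :
    ¬ RanksLast w x l c := by
  rintro ⟨h1, h2⟩
  obtain ⟨u, hu, hux⟩ := hx
  rcases hlast w hw with hwx | hwy
  · exact absurd (hfree w hw hwx l hl) (by omega)
  · have h3 := hwy.2 x hux.1 hxy
    have hcx : c ≠ x := by rintro rfl; omega
    exact hop w hw u hu ⟨l, x, y, c, h1, h3, h2, hux.2 y hy hxy.symm, hfree u hu hux l hl,
      hux.2 c hc hcx⟩

/-- One or two candidates can be placed as long as at least two are unplaced. -/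
theorem exists_extension [Fintype C] (h : PartialAxis S f) (hne : S.Nonempty) (hinj : ∀ w ∈ S, w.Injective)
    (hwd : ∀ u₁ ∈ S, ∀ u₂ ∈ S, ∀ u₃ ∈ S, ¬ WorstDiverse u₁ u₂ u₃)
    (hop : ∀ u ∈ S, ∀ u' ∈ S, ¬ Opposed u u') {p q : C} (hp : f p = 0) (hq : f q = 0)
    (hpq : p ≠ q) :
    ∃ g, PartialAxis S g ∧ (∃ x, f x = 0 ∧ g x ≠ 0) ∧ ∀ c, g c = 0 → f c = 0 := by
  have ext : ∀ {f g : C → ℤ} {x : C}, f x = 0 → (∀ p, p ≠ x → g p = f p) → ∀ c, g c = 0 → f c = 0 :=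
    fun {f g x} hx hg c hc => by
      by_cases hcx : c = x
      · rwa [hcx]
      · rwa [← hg c hcx]
  obtain ⟨w₀, hw₀⟩ := hne
  obtain ⟨x, hx⟩ := exists_last hinj hw₀ hp
  have other : ∀ z, ∃ d, f d = 0 ∧ d ≠ z := fun z => by
    by_cases hz : p = z
    · exact ⟨q, hq, fun e => hpq (hz.trans e.symm)⟩
    · exact ⟨p, hp, hz⟩
  have free : ∀ z, LeftFree S f z ∨ LeftFree S (-f) z := fun z => by
    obtain ⟨d, hd, hdz⟩ := other z
    exact h.leftFree_or hinj hop hd hdz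
  by_cases hall : ∀ w ∈ S, LastUnplaced f w x
  · have last : ∀ w ∈ S, ∀ r, ∀ c, f c = 0 → ¬ RanksLast w c x r := fun w hw r c hc hr => by
      by_cases hcx : c = x
      · subst hcx; exact lt_irrefl _ hr.1
      · exact absurd ((hall w hw).2 c hc hcx) (not_lt.2 hr.1.le)
    rcases free x with hf | hf
    · obtain ⟨g, hg, hgx, hgp⟩ := h.place_left hx.1
        (fun w hw l hl c _ hr => absurd (hf w hw (hall w hw) l hl) (not_lt.2 hr.1.le))
        (fun w hw r _ => last w hw r) ⟨w₀, hw₀, hx⟩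
      exact ⟨g, hg, ⟨x, hx.1, hgx.ne⟩, ext hx.1 hgp⟩
    · obtain ⟨g, hg, hgx, hgp⟩ := h.place_right hx.1
        (fun w hw l hl c _ hr => absurd (hf w hw (lastUnplaced_neg.2 (hall w hw)) l (by simpa using hl))
          (not_lt.2 hr.1.le))
        (fun w hw r _ => last w hw r) ⟨w₀, hw₀, hx⟩
      exact ⟨g, hg, ⟨x, hx.1, hgx.ne'⟩, ext hx.1 hgp⟩
  · push Not at hall
    obtain ⟨w₁, hw₁, hnx⟩ := hall
    obtain ⟨y, hy⟩ := exists_last hinj hw₁ hp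
    have hxy : x ≠ y := fun e => hnx (e ▸ hy)
    have hlast : ∀ w ∈ S, LastUnplaced f w x ∨ LastUnplaced f w y := fun w hw => by
      obtain ⟨z, hz⟩ := exists_last hinj hw hp
      by_contra! hcon
      have hzx : z ≠ x := fun e => hcon.1 (e ▸ hz)
      have hzy : z ≠ y := fun e => hcon.2 (e ▸ hz)
      exact hwd w₀ hw₀ w₁ hw₁ w hw ⟨x, y, z, ⟨hx.2 y hy.1 hxy.symm, hx.2 z hz.1 hzx⟩,
        ⟨hy.2 x hx.1 hxy, hy.2 z hz.1 hzy⟩, hz.2 x hx.1 hzx.symm, hz.2 y hy.1 hzy.symm⟩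
    -- both orders of the two candidates are treated at once
    have key : ∀ x y, x ≠ y → (∃ u ∈ S, LastUnplaced f u x) → (∃ u ∈ S, LastUnplaced f u y) →
        (∀ w ∈ S, LastUnplaced f w x ∨ LastUnplaced f w y) → LeftFree S f x → LeftFree S (-f) y →
        ∃ g, PartialAxis S g ∧ (∃ x, f x = 0 ∧ g x ≠ 0) ∧ ∀ c, g c = 0 → f c = 0 := by
      intro x y hxy hux huy hlast hfx hfy
      have hx : f x = 0 := by obtain ⟨u, -, hu⟩ := hux; exact hu.1
      have hy : f y = 0 := by obtain ⟨u, -, hu⟩ := huy; exact hu.1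
      have hfy' : ∀ w ∈ S, LastUnplaced f w y → ∀ r, 0 < f r → w y < w r := fun w hw hwy r hr =>
        hfy w hw (lastUnplaced_neg.2 hwy) r (by simpa using hr)
      obtain ⟨g, hg, hgx, hgp⟩ := h.place_left hx
        (fun w hw l hl c hc => not_ranksLast_of_leftFree hop hxy hux hy hlast hfx hw hl hc)
        (fun w hw r hr c hc hcon => by
          have hcx : c ≠ x := by rintro rfl; exact lt_irrefl _ hcon.1
          rcases hlast w hw with hwx | hwy
          · exact absurd (hwx.2 c hc hcx) (not_lt.2 hcon.1.le)
          · have h1 := hfy' w hw hwy r hr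
            have h2 : w c ≤ w y := by
              by_cases hcy : c = y
              · rw [hcy]
              · exact (hwy.2 c hc hcy).le
            exact absurd hcon.2 (by omega)) hux
      have hgy : g y = 0 := (hgp y hxy.symm).trans hy
      have g0 := ext hx hgp
      have hneg : ∀ {w z}, LastUnplaced (-f) w z ↔ LastUnplaced f w z := lastUnplaced_neg
      obtain ⟨g', hg', hgy', hgp'⟩ := hg.place_right hgy
        (fun w hw r hr c hc => by
          have hrx : r ≠ x := by rintro rfl; omega
          rw [hgp r hrx] at hr
          exact not_ranksLast_of_leftFree (f := -f) hop hxy.symm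
            (by simpa only [hneg] using huy) (by simpa using hx)
            (by simpa only [hneg, or_comm] using hlast) hfy hw
            (by simpa using hr) (by simpa using g0 c hc))
        (fun w hw l hl c hc hcon => by
          have hc' := g0 c hc
          have hcx : c ≠ x := by rintro rfl; omega
          have hcy : c ≠ y := by rintro rfl; exact lt_irrefl _ hcon.1
          rcases hlast w hw with hwx | hwy
          · by_cases hlx : l = x
            · subst hlx
              exact absurd (hwx.2 c hc' hcx) (not_lt.2 hcon.2.le)
            · rw [hgp l hlx] at hl
              have h1 := hfx w hw hwx l hl
              have h2 := hwx.2 c hc' hcx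
              exact absurd hcon.2 (by omega)
          · exact absurd (hwy.2 c hc' hcy) (not_lt.2 hcon.1.le))
        (by
          obtain ⟨u, hu, hlu⟩ := huy
          exact ⟨u, hu, hgy, fun c hc hcy => hlu.2 c (g0 c hc) hcy⟩)
      exact ⟨g', hg', ⟨y, hy, hgy'.ne'⟩, fun c hc => g0 c (ext hgy hgp' c hc)⟩
    have hux : ∃ u ∈ S, LastUnplaced f u x := ⟨w₀, hw₀, hx⟩
    have huy : ∃ u ∈ S, LastUnplaced f u y := ⟨w₁, hw₁, hy⟩
    have hleft := h.leftFree_or_leftFree hinj hwd hxy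
    have hright := h.neg.leftFree_or_leftFree hinj hwd hxy
    by_cases hx' : LeftFree S f x ∧ LeftFree S (-f) y
    · exact key x y hxy hux huy hlast hx'.1 hx'.2
    · obtain ⟨h1, h2⟩ : LeftFree S f y ∧ LeftFree S (-f) x := by
        rcases free x with h1 | h1 <;> rcases free y with h2 | h2 <;> rcases hleft with h3 | h3 <;>
          rcases hright with h4 | h4 <;> first | exact ⟨‹_›, ‹_›⟩ | exact absurd ⟨‹_›, ‹_›⟩ hx'
      exact key y x hxy.symm huy hux (fun w hw => (hlast w hw).symm) h1 h2

/-- A partial axis can be completed. -/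
theorem exists_completion [Fintype C] (hne : S.Nonempty) (hinj : ∀ w ∈ S, w.Injective)
    (hwd : ∀ u₁ ∈ S, ∀ u₂ ∈ S, ∀ u₃ ∈ S, ¬ WorstDiverse u₁ u₂ u₃)
    (hop : ∀ u ∈ S, ∀ u' ∈ S, ¬ Opposed u u') (k : ℕ) :
    ∀ {f : C → ℤ}, PartialAxis S f → (Finset.univ.filter fun c => f c = 0).card = k →
      ∃ g : C → ℤ, g.Injective ∧ PeakedAlong S g := by
  induction k using Nat.strong_induction_on with
  | _ k ih =>
    intro f h hk
    by_cases hf : ∀ p q, f p = 0 → f q = 0 → p = q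
    · refine ⟨f, fun a b hab => ?_, h.peaked⟩
      rcases h.inj a b hab with e | e
      · exact e
      · exact hf a b e (hab ▸ e)
    · push Not at hf
      obtain ⟨p, q, hp, hq, hpq⟩ := hf
      obtain ⟨g, hg, ⟨x, hfx, hgx⟩, hsub⟩ := h.exists_extension hne hinj hwd hop hp hq hpq
      refine ih _ ?_ hg rfl
      rw [← hk]
      refine Finset.card_lt_card (Finset.ssubset_iff_of_subset ?_ |>.2 ⟨x, by simpa using hfx,
        by simpa using hgx⟩)
      intro c hc
      simpa using hsub c (by simpa using hc)

end PartialAxis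

/-- Votes are single-peaked with respect to a common axis as soon as no three of them are
worst-diverse and no two of them are opposed. -/
theorem exists_peakedAlong [Fintype C] (hinj : ∀ w ∈ S, w.Injective)
    (hwd : ∀ u₁ ∈ S, ∀ u₂ ∈ S, ∀ u₃ ∈ S, ¬ WorstDiverse u₁ u₂ u₃)
    (hop : ∀ u ∈ S, ∀ u' ∈ S, ¬ Opposed u u') :
    ∃ f : C → ℤ, f.Injective ∧ PeakedAlong S f := by
  rcases S.eq_empty_or_nonempty with rfl | hne
  · refine ⟨fun c => (Fintype.equivFin C c : ℕ), fun a b h => ?_, fun w hw => hw.elim⟩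
    simpa [Fin.val_inj] using h
  · refine PartialAxis.exists_completion hne hinj hwd hop _ (f := fun _ => 0)
      ⟨fun _ _ _ => Or.inr rfl, fun _ _ _ _ _ h => absurd h (lt_irrefl _), fun _ h => absurd rfl h,
        fun _ h => absurd rfl h⟩ rfl

end Helly

/-! ### Reduction to satisfiability of clauses with two literals -/

/-- An implication graph on literals that is closed under contraposition has a consistent closed set
of literals that decides each literal in `s`, unless some literal and its negation imply each
other. -/
theorem exists_consistent_closed {L : Type*} {neg : L → L} (hneg : neg.Involutive)
    {E : L → L → Prop} (hE : ∀ x y, E x y → E (neg y) (neg x))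
    (hno : ∀ x, ¬ (Relation.TransGen E x (neg x) ∧ Relation.TransGen E (neg x) x)) {s : Finset L}
    (hs : ∀ x ∈ s, neg x ≠ x) :
    ∃ A : Set L, (∀ x ∈ A, ∀ y, E x y → y ∈ A) ∧ (∀ x ∈ A, neg x ∉ A) ∧
      ∀ x ∈ s, x ∈ A ∨ neg x ∈ A := by
  classical
  have contra : ∀ {x y}, Relation.ReflTransGen E x y → Relation.ReflTransGen E (neg y) (neg x) := by
    intro x y h
    induction h with
    | refl => exact .refl
    | tail _ h ih => exact .head (hE _ _ h) ih
  induction s using Finset.induction_on with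
  | empty => exact ⟨∅, by simp, by simp, by simp⟩
  | insert x s _ ih =>
    obtain ⟨A, hcl, hcon, hdec⟩ := ih fun y hy => hs y (Finset.mem_insert_of_mem hy)
    have hsx := hs x (Finset.mem_insert_self x s)
    have hclT : ∀ x ∈ A, ∀ y, Relation.ReflTransGen E x y → y ∈ A := by
      intro x hx y h
      induction h with
      | refl => exact hx
      | tail _ h ih => exact hcl _ ih _ h
    -- an undecided literal that does not imply its negation is added with all its consequences
    have key : ∀ x, neg x ≠ x → neg x ∉ A → ¬ Relation.TransGen E x (neg x) →
        ∃ A : Set L, (∀ x ∈ A, ∀ y, E x y → y ∈ A) ∧ (∀ x ∈ A, neg x ∉ A) ∧ x ∈ A ∧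
          ∀ x ∈ s, x ∈ A ∨ neg x ∈ A := by
      intro x hself hnx hT
      refine ⟨A ∪ {y | Relation.ReflTransGen E x y}, ?_, ?_, Or.inr .refl, fun y hy => ?_⟩
      · rintro y (hy | hy) z hz
        · exact Or.inl (hcl y hy z hz)
        · exact Or.inr (hy.tail hz)
      · rintro y (hy | hy) (hy' | hy')
        · exact hcon y hy hy'
        · refine hnx (hclT y hy _ ?_)
          simpa [hneg y] using contra hy'
        · refine hnx (hclT _ hy' _ (contra hy))
        · have h1 : Relation.ReflTransGen E y (neg x) := by simpa [hneg y] using contra hy'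
          have h2 : Relation.ReflTransGen E x (neg x) := Relation.ReflTransGen.trans hy h1
          rcases Relation.reflTransGen_iff_eq_or_transGen.1 h2 with e | h2
          · exact hself e
          · exact hT h2
      · rcases hdec y hy with h | h
        · exact Or.inl (Or.inl h)
        · exact Or.inr (Or.inl h)
    by_cases hx : x ∈ A ∨ neg x ∈ A
    · refine ⟨A, hcl, hcon, fun y hy => ?_⟩
      rcases Finset.mem_insert.1 hy with rfl | hy
      · exact hx
      · exact hdec y hy
    · push Not at hx
      by_cases hT : Relation.TransGen E x (neg x)
      · have hT' : ¬ Relation.TransGen E (neg x) (neg (neg x)) := by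
          rw [hneg x]; exact fun h => hno x ⟨hT, h⟩
        obtain ⟨A, h1, h2, h3, h4⟩ := key (neg x) (by rw [hneg x]; exact hsx.symm)
          (by rw [hneg x]; exact hx.1) hT'
        refine ⟨A, h1, h2, fun y hy => ?_⟩
        rcases Finset.mem_insert.1 hy with rfl | hy
        · exact Or.inr h3
        · exact h4 y hy
      · obtain ⟨A, h1, h2, h3, h4⟩ := key x hsx hx.2 hT
        refine ⟨A, h1, h2, fun y hy => ?_⟩
        rcases Finset.mem_insert.1 hy with rfl | hy
        · exact Or.inl h3
        · exact h4 y hy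

/-- The implication graph of the clauses "`i` and `j` are not both in part `1`" for `K₁ i j` and
"`i` and `j` are not both in part `2`" for `K₂ i j`, where `i, j < n`. The number `i < n` stands for
the literal "`i` is in part `1`", and `n + i` for the literal "`i` is in part `2`". -/
def ClauseEdge (n : ℕ) (K₁ K₂ : ℕ → ℕ → Prop) (p q : ℕ) : Prop :=
  (p < n ∧ n ≤ q ∧ q < n + n ∧ K₁ p (q - n)) ∨ (n ≤ p ∧ p < n + n ∧ q < n ∧ K₂ (p - n) q)

/-- The satisfiability of clauses with two literals: a partition exists unless the two literals of
some `i` imply each other. -/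
theorem exists_partition_iff {n : ℕ} {K₁ K₂ : ℕ → ℕ → Prop} (h₁ : ∀ i j, K₁ i j → K₁ j i)
    (h₂ : ∀ i j, K₂ i j → K₂ j i) :
    (∃ z : ℕ → Prop, ∀ i < n, ∀ j < n, (z i → z j → ¬ K₁ i j) ∧ (¬ z i → ¬ z j → ¬ K₂ i j)) ↔
      ¬ ∃ i < n, Relation.TransGen (ClauseEdge n K₁ K₂) i (n + i) ∧
        Relation.TransGen (ClauseEdge n K₁ K₂) (n + i) i := by
  constructor
  · rintro ⟨z, hz⟩ ⟨i, hi, h, h'⟩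
    -- the literals that are true under `z` are closed under implication
    have sound : ∀ {p q}, Relation.TransGen (ClauseEdge n K₁ K₂) p q →
        ((p < n ∧ z p) ∨ (n ≤ p ∧ ¬ z (p - n))) → ((q < n ∧ z q) ∨ (n ≤ q ∧ ¬ z (q - n))) := by
      have edge : ∀ {p q}, ClauseEdge n K₁ K₂ p q →
          ((p < n ∧ z p) ∨ (n ≤ p ∧ ¬ z (p - n))) → ((q < n ∧ z q) ∨ (n ≤ q ∧ ¬ z (q - n))) := by
        rintro p q (⟨hp, hq, hq', hK⟩ | ⟨hp, hp', hq, hK⟩) hpz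
        · have hzp : z p := by
            rcases hpz with h | h
            · exact h.2
            · omega
          exact Or.inr ⟨hq, fun hzq => (hz p hp (q - n) (by omega)).1 hzp hzq hK⟩
        · have hzp : ¬ z (p - n) := by
            rcases hpz with h | h
            · omega
            · exact h.2
          exact Or.inl ⟨hq, by_contra fun hzq => (hz (p - n) (by omega) q hq).2 hzp hzq hK⟩
      intro p q h
      induction h with
      | single h => exact edge h
      | tail _ h ih => exact fun hp => edge h (ih hp)
    by_cases hzi : z i
    · rcases sound h (Or.inl ⟨hi, hzi⟩) with h | h
      · omega
      · exact h.2 (by simpa using hzi)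
    · rcases sound h' (Or.inr ⟨by omega, by simpa using hzi⟩) with h | h
      · exact hzi h.2
      · omega
  · intro hno
    set neg : ℕ → ℕ := fun p => if p < n then p + n else if p < n + n then p - n else p with hnegdef
    have neg1 : ∀ {p}, p < n → neg p = p + n := fun {p} h => by simp [hnegdef, h]
    have neg2 : ∀ {p}, n ≤ p → p < n + n → neg p = p - n := fun {p} h h' => by
      simp [hnegdef, h', not_lt.2 h]
    have neg3 : ∀ {p}, n + n ≤ p → neg p = p := fun {p} h => by
      simp [hnegdef, not_lt.2 h, show ¬ p < n by omega]
    obtain ⟨A, hcl, hcon, hdec⟩ := exists_consistent_closed (neg := neg) (E := ClauseEdge n K₁ K₂)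
      (fun p => by
        rcases lt_or_ge p n with h | h
        · rw [neg1 h, neg2 (by omega) (by omega)]; omega
        · rcases lt_or_ge p (n + n) with h' | h'
          · rw [neg2 h h', neg1 (by omega)]; omega
          · rw [neg3 h', neg3 h'])
      (by
        rintro p q (⟨hp, hq, hq', hK⟩ | ⟨hp, hp', hq, hK⟩)
        · rw [neg1 hp, neg2 hq hq']
          exact Or.inl ⟨by omega, by omega, by omega, h₁ _ _ (by simpa using hK)⟩
        · rw [neg2 hp hp', neg1 hq]
          exact Or.inr ⟨by omega, by omega, by omega, h₂ _ _ (by simpa using hK)⟩)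
      (by
        rintro p ⟨h, h'⟩
        rcases lt_or_ge p n with hp | hp
        · rw [neg1 hp, Nat.add_comm] at h h'
          exact hno ⟨p, hp, h, h'⟩
        · rcases lt_or_ge p (n + n) with hp' | hp'
          · rw [neg2 hp hp'] at h h'
            refine hno ⟨p - n, by omega, ?_⟩
            rw [show n + (p - n) = p by omega]
            exact ⟨h', h⟩
          · obtain ⟨q, hq, -⟩ := Relation.TransGen.head'_iff.1 h
            rcases hq with hq | hq <;> omega)
      (s := Finset.range n)
      (fun p hp => by
        have hp := Finset.mem_range.1 hp
        rw [neg1 hp]; omega)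
    refine ⟨fun i => i ∈ A, fun i hi j hj => ⟨fun hiA hjA hK => ?_, fun hiA hjA hK => ?_⟩⟩
    · refine hcon j hjA (hcl i hiA _ ?_)
      rw [neg1 hj]
      exact Or.inl ⟨hi, by omega, by omega, by simpa using hK⟩
    · have hi' := (hdec i (Finset.mem_range.2 hi)).resolve_left hiA
      rw [neg1 hi] at hi'
      exact hjA (hcl _ hi' _ (Or.inr ⟨by omega, by omega, hj, by simpa using hK⟩))

/-- Warshall's algorithm: if the `k`-th round adds the paths through the vertex `k`, then the
transitive closure is reached after all rounds. -/
theorem warshall {N : ℕ} {R : ℕ → ℕ → ℕ → Prop}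
    (hR : ∀ k < N, ∀ p < N, ∀ q < N, R (k + 1) p q ↔ R k p q ∨ (R k p k ∧ R k k q))
    {E : ℕ → ℕ → Prop} (hE : ∀ p q, E p q → p < N ∧ q < N)
    (h0 : ∀ p < N, ∀ q < N, R 0 p q ↔ E p q) {p q : ℕ} (hp : p < N) (hq : q < N) :
    R N p q ↔ Relation.TransGen E p q := by
  constructor
  · have : ∀ k ≤ N, ∀ p < N, ∀ q < N, R k p q → Relation.TransGen E p q := by
      intro k
      induction k with
      | zero => exact fun _ p hp q hq h => .single ((h0 p hp q hq).1 h)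
      | succ k ih =>
        intro hk p hp q hq h
        rcases (hR k hk p hp q hq).1 h with h | ⟨h, h'⟩
        · exact ih (by omega) p hp q hq h
        · exact (ih (by omega) p hp k hk h).trans (ih (by omega) k hk q hq h')
    exact this N le_rfl p hp q hq
  · -- after `k` rounds, paths can be joined at all vertices below `k`
    have join : ∀ k ≤ N, ∀ a < k, ∀ p < N, ∀ q < N, R k p a → R k a q → R k p q := by
      intro k
      induction k with
      | zero => exact fun _ a ha => absurd ha (Nat.not_lt_zero a)
      | succ k ih =>
        intro hk a ha p hp q hq h h'
        have ih := ih (by omega)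
        rw [hR k hk p hp a (by omega)] at h
        rw [hR k hk a (by omega) q hq] at h'
        rw [hR k hk p hp q hq]
        rcases Nat.lt_succ_iff_lt_or_eq.1 ha with ha | rfl
        · have i1 := ih a ha p hp q hq
          have i2 := ih a ha p hp k hk
          have i3 := ih a ha k hk q hq
          tauto
        · tauto
    have mono : ∀ k ≤ N, ∀ p < N, ∀ q < N, E p q → R k p q := by
      intro k
      induction k with
      | zero => exact fun _ p hp q hq h => (h0 p hp q hq).2 h
      | succ k ih => exact fun hk p hp q hq h =>
          (hR k hk p hp q hq).2 (Or.inl (ih (by omega) p hp q hq h))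
    intro h
    induction h with
    | single h => exact mono N le_rfl p hp _ hq h
    | @tail b c _ h ih =>
      have hb := (hE _ _ h).1
      exact join N le_rfl b hb p hp c hq (ih hb) (mono N le_rfl b hb c hq h)

/-! ### Two axes -/

section TwoAxes

variable {C : Type*}

/-- Among three candidates, a vote ranks one last. -/
theorem ranksLast_cases {w : C → ℕ} (hw : w.Injective) {a b c : C} (hab : a ≠ b) (hac : a ≠ c)
    (hbc : b ≠ c) : RanksLast w a b c ∨ RanksLast w b a c ∨ RanksLast w c a b := by
  have h1 := hw.ne hab
  have h2 := hw.ne hac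
  have h3 := hw.ne hbc
  unfold RanksLast
  omega

theorem WorstDiverse.swap {u₁ u₂ u₃ : C → ℕ} (h : WorstDiverse u₁ u₂ u₃) :
    WorstDiverse u₁ u₃ u₂ := by
  obtain ⟨a, b, c, ha, hb, hc⟩ := h
  exact ⟨a, c, b, ha.symm, hc, hb⟩

theorem Opposed.symm {u u' : C → ℕ} (h : Opposed u u') : Opposed u' u := by
  obtain ⟨a, b, c, d, h1, h2, h3, h4, h5, h6⟩ := h
  exact ⟨c, b, a, d, h4, h5, h6, h1, h2, h3⟩

/-- If three votes are worst-diverse, then so are two of them together with any given vote `v`. -/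
theorem WorstDiverse.exists_of_vote {u₁ u₂ u₃ v : C → ℕ} (hv : v.Injective)
    (h : WorstDiverse u₁ u₂ u₃) :
    WorstDiverse v u₂ u₃ ∨ WorstDiverse v u₁ u₃ ∨ WorstDiverse v u₁ u₂ := by
  obtain ⟨a, b, c, ha, hb, hc⟩ := h
  have hab : a ≠ b := by rintro rfl; exact lt_irrefl _ ha.1
  have hac : a ≠ c := by rintro rfl; exact lt_irrefl _ ha.2
  have hbc : b ≠ c := by rintro rfl; exact lt_irrefl _ hb.2
  rcases ranksLast_cases hv hab hac hbc with h | h | h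
  · exact Or.inl ⟨a, b, c, h, hb, hc⟩
  · exact Or.inr (Or.inl ⟨b, a, c, h, ha, hc.symm⟩)
  · exact Or.inr (Or.inr ⟨c, a, b, h, ha.symm, hb.symm⟩)

/-- The votes `u` and `u'` cannot be in the same part as `v` if the parts are single-peaked. -/
def Conflict (v u u' : C → ℕ) : Prop :=
  Opposed u u' ∨ WorstDiverse v u u'

theorem Conflict.symm {v u u' : C → ℕ} (h : Conflict v u u') : Conflict v u' u :=
  h.imp Opposed.symm WorstDiverse.swap

/-- The votes in `S` are single-peaked with respect to a common axis. -/
def SinglePeaked (S : Set (C → ℕ)) : Prop :=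
  ∃ f : C → ℤ, f.Injective ∧ PeakedAlong S f

/-- If `v` is any vote, then votes are single-peaked as soon as there is no conflict among them
relative to `v`. -/
theorem singlePeaked_of_not_conflict [Fintype C] {S : Set (C → ℕ)} {v : C → ℕ} (hv : v.Injective)
    (hinj : ∀ w ∈ S, w.Injective) (h : ∀ u ∈ S, ∀ u' ∈ S, ¬ Conflict v u u') : SinglePeaked S := by
  refine exists_peakedAlong hinj (fun u₁ h₁ u₂ h₂ u₃ h₃ hwd => ?_)
    (fun u hu u' hu' hop => h u hu u' hu' (Or.inl hop))
  rcases hwd.exists_of_vote hv with hw | hw | hw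
  · exact h u₂ h₂ u₃ h₃ (Or.inr hw)
  · exact h u₁ h₁ u₃ h₃ (Or.inr hw)
  · exact h u₁ h₁ u₂ h₂ (Or.inr hw)

theorem SinglePeaked.not_conflict {S : Set (C → ℕ)} (hS : SinglePeaked S) {v u u' : C → ℕ}
    (hv : v ∈ S) (hu : u ∈ S) (hu' : u' ∈ S) : ¬ Conflict v u u' := by
  obtain ⟨f, hf, hp⟩ := hS
  rintro (h | h)
  · exact hp.not_opposed hf hu hu' h
  · exact hp.not_worstDiverse hf hv hu hu' h

/-- The votes `u i`, where `i < n`, can be partitioned into two single-peaked parts. -/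
def TwoAxes (n : ℕ) (u : ℕ → C → ℕ) : Prop :=
  ∃ z : ℕ → Prop, SinglePeaked {w | ∃ i < n, z i ∧ w = u i} ∧
    SinglePeaked {w | ∃ i < n, ¬ z i ∧ w = u i}

/-- The votes can be partitioned so that there are no conflicts relative to `u a` in the first part
and no conflicts relative to `u b` in the second one. -/
def Separable (n : ℕ) (u : ℕ → C → ℕ) (a b : ℕ) : Prop :=
  ∃ z : ℕ → Prop, ∀ i < n, ∀ j < n, (z i → z j → ¬ Conflict (u a) (u i) (u j)) ∧
    (¬ z i → ¬ z j → ¬ Conflict (u b) (u i) (u j))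

/-- Two of the three votes `a, b, c` are in different parts if they are worst-diverse. -/
theorem twoAxes_iff [Fintype C] {n : ℕ} {u : ℕ → C → ℕ} (hu : ∀ i < n, (u i).Injective)
    {a b c : ℕ} (ha : a < n) (hb : b < n) (hc : c < n)
    (h : WorstDiverse (u a) (u b) (u c) ∨
      ∀ i < n, ∀ j < n, ∀ k < n, ¬ WorstDiverse (u i) (u j) (u k)) :
    TwoAxes n u ↔ Separable n u a b ∨ Separable n u a c ∨ Separable n u b c := by
  constructor
  · rintro ⟨z, h₁, h₂⟩
    have sep : ∀ {p q}, p < n → q < n → z p → ¬ z q → Separable n u p q :=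
      fun {p q} hp hq hzp hzq => ⟨z, fun i hi j hj =>
        ⟨fun hzi hzj => h₁.not_conflict ⟨p, hp, hzp, rfl⟩ ⟨i, hi, hzi, rfl⟩ ⟨j, hj, hzj, rfl⟩,
          fun hzi hzj => h₂.not_conflict ⟨q, hq, hzq, rfl⟩ ⟨i, hi, hzi, rfl⟩ ⟨j, hj, hzj, rfl⟩⟩⟩
    have swap : ∀ {p q}, Separable n u p q → Separable n u q p := fun {p q} ⟨z, hz⟩ =>
      ⟨fun i => ¬ z i, fun i hi j hj => ⟨(hz i hi j hj).2, fun hzi hzj =>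
        (hz i hi j hj).1 (not_not.1 hzi) (not_not.1 hzj)⟩⟩
    rcases h with h | h
    -- the three votes cannot be in one part, and two in different parts make the votes separable
    · by_cases za : z a <;> by_cases zb : z b <;> by_cases zc : z c
      · exact absurd (Or.inr h) (h₁.not_conflict (v := u a) (u := u b) (u' := u c)
          ⟨a, ha, za, rfl⟩ ⟨b, hb, zb, rfl⟩ ⟨c, hc, zc, rfl⟩)
      · exact Or.inr (Or.inl (sep ha hc za zc))
      · exact Or.inl (sep ha hb za zb)
      · exact Or.inl (sep ha hb za zb)
      · exact Or.inl (swap (sep hb ha zb za))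
      · exact Or.inl (swap (sep hb ha zb za))
      · exact Or.inr (Or.inl (swap (sep hc ha zc za)))
      · exact absurd (Or.inr h) (h₂.not_conflict (v := u a) (u := u b) (u' := u c)
          ⟨a, ha, za, rfl⟩ ⟨b, hb, zb, rfl⟩ ⟨c, hc, zc, rfl⟩)
    · refine Or.inl ⟨z, fun i hi j hj => ⟨fun hzi hzj hcon => ?_, fun hzi hzj hcon => ?_⟩⟩
      · rcases hcon with hcon | hcon
        · exact h₁.not_conflict (v := u i) ⟨i, hi, hzi, rfl⟩ ⟨i, hi, hzi, rfl⟩ ⟨j, hj, hzj, rfl⟩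
            (Or.inl hcon)
        · exact h a ha i hi j hj hcon
      · rcases hcon with hcon | hcon
        · exact h₂.not_conflict (v := u i) ⟨i, hi, hzi, rfl⟩ ⟨i, hi, hzi, rfl⟩ ⟨j, hj, hzj, rfl⟩
            (Or.inl hcon)
        · exact h b hb i hi j hj hcon
  · have main : ∀ {p q}, p < n → q < n → Separable n u p q → TwoAxes n u := by
      rintro p q hp hq ⟨z, hz⟩
      refine ⟨z, singlePeaked_of_not_conflict (hu p hp) ?_ ?_,
        singlePeaked_of_not_conflict (hu q hq) ?_ ?_⟩
      · rintro w ⟨i, hi, -, rfl⟩; exact hu i hi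
      · rintro w ⟨i, hi, hzi, rfl⟩ w' ⟨j, hj, hzj, rfl⟩
        exact (hz i hi j hj).1 hzi hzj
      · rintro w ⟨i, hi, -, rfl⟩; exact hu i hi
      · rintro w ⟨i, hi, hzi, rfl⟩ w' ⟨j, hj, hzj, rfl⟩
        exact (hz i hi j hj).2 hzi hzj
    rintro (h | h | h)
    · exact main ha hb h
    · exact main ha hc h
    · exact main hb hc h

end TwoAxes

namespace RAM

/-! ### The program -/

namespace Exp

/-- The value of `toBool e` is `1` if the value of `e` is nonzero, and `0` otherwise. -/
def toBool (e : Exp) : Exp := .sub (.const 1) (.sub (.const 1) e)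

/-- The position of the candidate `c`, a variable, in the vote number `u`. The variable `0` holds
the number of candidates. -/
def position (u : Exp) (c : ℕ) : Exp := .load (.add (.const 2) (.add (.mul u (.var 0)) (.var c)))

/-- Nonzero iff the vote number `u` ranks the candidate `a` above `b`. -/
def above (u : Exp) (a b : ℕ) : Exp := .sub (position u b) (position u a)

/-- Nonzero iff the votes number `u₁, u₂, u₃` are worst-diverse. -/
def worstDiverse (u₁ u₂ u₃ : Exp) : Exp :=
  .search 20 0 (.search 21 0 (.search 22 0
    (.mul (.mul (above u₁ 21 20) (above u₁ 22 20)) (.mul (.mul (above u₂ 20 21) (above u₂ 22 21))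
      (.mul (above u₃ 20 22) (above u₃ 21 22))))))

/-- Nonzero iff the votes number `u, u'` are opposed. -/
def opposed (u u' : Exp) : Exp :=
  .search 20 0 (.search 21 0 (.search 22 0 (.search 23 0
    (.mul (above u 20 21) (.mul (above u 21 22) (.mul (above u 23 21)
      (.mul (above u' 22 21) (.mul (above u' 21 20) (above u' 23 21)))))))))

/-- Nonzero iff the votes number `u, u'` are in conflict relative to the vote number `v`. -/
def conflict (v u u' : Exp) : Exp := .add (opposed u u') (worstDiverse v u u')

/-- The address of the entry `(p, q)` of a square table, whose size is held by the variable `2`, and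
which starts at the address held by the variable `3`. -/
def entry (p q : Exp) : Exp := .add (.var 3) (.add (.mul p (.var 2)) q)

/-- Nonzero iff there is an edge from `p` to `q` in the implication graph, where `p` and `q` are
held by the variables `10` and `11`. The variable `1` holds the number of votes, and the variables
`a` and `b` the numbers of the votes that conflicts are relative to. -/
def edge (a b : ℕ) : Exp :=
  .add
    (.mul (.sub (.var 1) (.var 10)) (.mul (.sub (.add (.var 11) (.const 1)) (.var 1))
      (conflict (.var a) (.var 10) (.sub (.var 11) (.var 1)))))
    (.mul (.sub (.add (.var 10) (.const 1)) (.var 1)) (.mul (.sub (.var 1) (.var 11))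
      (conflict (.var b) (.sub (.var 10) (.var 1)) (.var 11))))

/-- Nonzero iff some literal and its negation imply each other. -/
def contradiction : Exp :=
  .search 10 1 (.mul (.load (entry (.var 10) (.add (.var 1) (.var 10))))
    (.load (entry (.add (.var 1) (.var 10)) (.var 10))))

end Exp

namespace Cmd

/-- Set all entries of the table; the row and the column are held by the variables `10`, `11`. -/
def setEntries (e : Exp) : Cmd :=
  .loop 10 2 (.loop 11 2 (.store (.entry (.var 10) (.var 11)) e))

/-- Add the paths through the vertex that is held by the variable `12`. -/
def addPaths : Cmd :=
  setEntries (Exp.toBool (.add (.load (.entry (.var 10) (.var 11)))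
    (.mul (.load (.entry (.var 10) (.var 12))) (.load (.entry (.var 12) (.var 11))))))

/-- Set the memory cell `0` to `1` if the votes are separable relative to the votes whose numbers
are held by the variables `a` and `b`. -/
def separable (a b : ℕ) : Cmd :=
  .seq (setEntries (Exp.edge a b).toBool) (.seq (.loop 12 2 addPaths)
    (.store (.const 0) (Exp.toBool (.add (.load (.const 0)) (.sub (.const 1) .contradiction)))))

/-- Test the three pairs of the votes whose numbers are held by the variables `4`, `5` and `6`. -/
def testPairs : Cmd :=
  .seq (.store (.const 0) (.const 0)) (.seq (separable 4 5) (.seq (separable 4 6) (separable 5 6)))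

/-- Find three worst-diverse votes, if there are any, and test their pairs. -/
def findVotes : Cmd :=
  .bind 4 (.sub (.search 7 1 (.search 8 1 (.search 9 1
    (.worstDiverse (.var 7) (.var 8) (.var 9))))) (.const 1)) <|
  .bind 5 (.sub (.search 8 1 (.search 9 1 (.worstDiverse (.var 4) (.var 8) (.var 9))))
    (.const 1)) <|
  .bind 6 (.sub (.search 9 1 (.worstDiverse (.var 4) (.var 5) (.var 9))) (.const 1)) testPairs

/-- The variables `0, …, 3` are the number of candidates, the number of votes (replaced by zero if
there are no candidates, since the program must not take a step for each vote then), twice this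
number, and the address of the table. -/
def twoAxes : Cmd :=
  .bind 0 (.load (.const 0)) <|
  .bind 1 (.mul (.load (.const 1)) (Exp.toBool (.var 0))) <|
  .bind 2 (.add (.var 1) (.var 1)) <|
  .bind 3 (.add (.const 2) (.mul (.var 1) (.var 0))) findVotes

end Cmd

/-! ### What the program computes -/

/-- The vote number `i` in the memory `mem`, for `m` candidates. -/
def vote (mem : ℕ → ℕ) (m i : ℕ) (c : Fin m) : ℕ := mem (2 + (i * m + c))

namespace Exp

/-- The value of the expression does not depend on the variables from `20` on, which stand for
candidates. -/
def Fresh (u : Exp) : Prop :=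
  ∀ mem ρ x k, 20 ≤ x → u.eval mem (Function.update ρ x k) = u.eval mem ρ

theorem fresh_var {x : ℕ} (hx : x < 20) : (var x).Fresh := fun mem ρ y k hy => by
  rw [eval, eval, Function.update_of_ne (by omega)]

theorem fresh_sub_var {x y : ℕ} (hx : x < 20) (hy : y < 20) : (sub (var x) (var y)).Fresh :=
  fun mem ρ z k hz => by
    simp only [eval]
    rw [Function.update_of_ne (by omega), Function.update_of_ne (by omega)]

variable {mem ρ : ℕ → ℕ}

theorem eval_toBool_eq_iff {e : Exp} {k : ℕ} :
    e.toBool.eval mem ρ = 1 - (1 - k) ↔ (e.eval mem ρ ≠ 0 ↔ k ≠ 0) := by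
  simp only [toBool, eval]
  omega

theorem eval_mul_ne_zero {a b : Exp} :
    (mul a b).eval mem ρ ≠ 0 ↔ a.eval mem ρ ≠ 0 ∧ b.eval mem ρ ≠ 0 := mul_ne_zero_iff

theorem eval_add_ne_zero {a b : Exp} :
    (add a b).eval mem ρ ≠ 0 ↔ a.eval mem ρ ≠ 0 ∨ b.eval mem ρ ≠ 0 := by
  simp only [eval]
  omega

theorem eval_sub_ne_zero {a b : Exp} :
    (sub a b).eval mem ρ ≠ 0 ↔ b.eval mem ρ < a.eval mem ρ := by
  simp only [eval]
  omega

theorem worstDiverse_ne_zero {m : ℕ} (hm : ρ 0 = m) {u₁ u₂ u₃ : Exp} (h₁ : u₁.Fresh) (h₂ : u₂.Fresh) (h₃ : u₃.Fresh) :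
    (worstDiverse u₁ u₂ u₃).eval mem ρ ≠ 0 ↔
      WorstDiverse (vote mem m (u₁.eval mem ρ)) (vote mem m (u₂.eval mem ρ))
        (vote mem m (u₃.eval mem ρ)) := by
  subst hm
  have f1 := fun ρ x k hx => h₁ mem ρ x k hx
  have f2 := fun ρ x k hx => h₂ mem ρ x k hx
  have f3 := fun ρ x k hx => h₃ mem ρ x k hx
  simp only [worstDiverse, eval_search_ne_zero, WorstDiverse, RanksLast, vote, Fin.exists_iff,
    above, position, eval_mul_ne_zero, eval_sub_ne_zero, exists_prop]
  simp [eval, f1, f2, f3]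

theorem opposed_ne_zero {m : ℕ} (hm : ρ 0 = m) {u u' : Exp} (h : u.Fresh) (h' : u'.Fresh) :
    (opposed u u').eval mem ρ ≠ 0 ↔
      Opposed (vote mem m (u.eval mem ρ)) (vote mem m (u'.eval mem ρ)) := by
  subst hm
  have f1 := fun ρ x k hx => h mem ρ x k hx
  have f2 := fun ρ x k hx => h' mem ρ x k hx
  simp only [opposed, eval_search_ne_zero, Opposed, vote, Fin.exists_iff,
    above, position, eval_mul_ne_zero, eval_sub_ne_zero, exists_prop]
  simp [eval, f1, f2]

theorem conflict_ne_zero {m : ℕ} (hm : ρ 0 = m) {v u u' : Exp} (hv : v.Fresh) (h : u.Fresh) (h' : u'.Fresh) :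
    (conflict v u u').eval mem ρ ≠ 0 ↔ Conflict (vote mem m (v.eval mem ρ))
      (vote mem m (u.eval mem ρ)) (vote mem m (u'.eval mem ρ)) := by
  rw [conflict, eval_add_ne_zero, opposed_ne_zero hm h h', worstDiverse_ne_zero hm hv h h', Conflict]

end Exp

/-- The variables `0, …, 3` have the values that `twoAxes` gives them, for `m` candidates and `n`
votes. -/
structure Sizes (m n : ℕ) (ρ : ℕ → ℕ) : Prop where
  zero : ρ 0 = m
  one : ρ 1 = n
  two : ρ 2 = n + n
  three : ρ 3 = 2 + n * m

theorem Sizes.update {m n : ℕ} {ρ : ℕ → ℕ} (h : Sizes m n ρ) {x : ℕ} (hx : 3 < x) (k : ℕ) :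
    Sizes m n (Function.update ρ x k) where
  zero := by rw [Function.update_of_ne (by omega), h.zero]
  one := by rw [Function.update_of_ne (by omega), h.one]
  two := by rw [Function.update_of_ne (by omega), h.two]
  three := by rw [Function.update_of_ne (by omega), h.three]

/-- The memory holds the votes `u i`, for `i < n`. -/
def HoldsVotes {m : ℕ} (n : ℕ) (u : ℕ → Fin m → ℕ) (mem : ℕ → ℕ) : Prop :=
  ∀ i < n, vote mem m i = u i

theorem HoldsVotes.congr {m n : ℕ} {u : ℕ → Fin m → ℕ} {mem mem' : ℕ → ℕ} (h : HoldsVotes n u mem)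
    (hm : ∀ a, 2 ≤ a → a < 2 + n * m → mem' a = mem a) : HoldsVotes n u mem' := by
  intro i hi
  rw [← h i hi]
  funext c
  have h1 : (i + 1) * m ≤ n * m := Nat.mul_le_mul_right m hi
  have h2 := c.2
  rw [Nat.succ_mul] at h1
  exact hm _ (by omega) (by omega)

theorem edge_ne_zero {m n : ℕ} {ρ mem : ℕ → ℕ} (hρ : Sizes m n ρ) {u : ℕ → Fin m → ℕ}
    (hu : HoldsVotes n u mem) {a b p q : ℕ} (ha : a < 10) (hb : b < 10) (han : 0 < n → ρ a < n)
    (hbn : 0 < n → ρ b < n) (hp : p < n + n) (hq : q < n + n) :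
    (Exp.edge a b).eval mem (Function.update (Function.update ρ 10 p) 11 q) ≠ 0 ↔
      ClauseEdge n (fun i j => Conflict (u (ρ a)) (u i) (u j))
        (fun i j => Conflict (u (ρ b)) (u i) (u j)) p q := by
  have hρ' := (hρ.update (by omega : 3 < 10) p).update (by omega : 3 < 11) q
  set ρ' := Function.update (Function.update ρ 10 p) 11 q with hρ'def
  have v10 : ρ' 10 = p := by simp [hρ'def]
  have v11 : ρ' 11 = q := by simp [hρ'def]
  have va : ρ' a = ρ a := by
    rw [hρ'def, Function.update_of_ne (by omega), Function.update_of_ne (by omega)]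
  have vb : ρ' b = ρ b := by
    rw [hρ'def, Function.update_of_ne (by omega), Function.update_of_ne (by omega)]
  have f : ∀ {x}, x < 20 → (Exp.var x).Fresh := Exp.fresh_var
  have f' : ∀ {x y}, x < 20 → y < 20 → (Exp.sub (.var x) (.var y)).Fresh := Exp.fresh_sub_var
  simp only [Exp.edge, Exp.eval_add_ne_zero, Exp.eval_mul_ne_zero, Exp.eval_sub_ne_zero,
    Exp.conflict_ne_zero hρ'.zero (f (by omega : a < 20)) (f (by omega : 10 < 20))
      (f' (by omega : 11 < 20) (by omega : 1 < 20)),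
    Exp.conflict_ne_zero hρ'.zero (f (by omega : b < 20)) (f' (by omega : 10 < 20) (by omega : 1 < 20))
      (f (by omega : 11 < 20))]
  simp only [Exp.eval, hρ'.one, v10, v11, va, vb, ClauseEdge]
  refine or_congr ?_ ?_
  · constructor
    · rintro ⟨h1, h2, h3⟩
      rw [hu _ (han (by omega)), hu p h1, hu (q - n) (by omega)] at h3
      exact ⟨h1, by omega, hq, h3⟩
    · rintro ⟨h1, h2, -, h3⟩
      rw [hu _ (han (by omega)), hu p h1, hu (q - n) (by omega)]
      exact ⟨h1, by omega, h3⟩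
  · constructor
    · rintro ⟨h1, h2, h3⟩
      rw [hu _ (hbn (by omega)), hu q h2, hu (p - n) (by omega)] at h3
      exact ⟨by omega, hp, h2, h3⟩
    · rintro ⟨h1, h2, h3, h4⟩
      rw [hu _ (hbn (by omega)), hu q h3, hu (p - n) (by omega)]
      exact ⟨by omega, h3, h4⟩

/-- The address of the entry `(p, q)` of the table. -/
def cell (m n p q : ℕ) : ℕ := 2 + n * m + (p * (n + n) + q)

theorem cell_inj {m n p q p' q' : ℕ} (hq : q < n + n) (hq' : q' < n + n)
    (h : cell m n p q = cell m n p' q') : p = p' ∧ q = q' := by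
  have h : p * (n + n) + q = p' * (n + n) + q' := by unfold cell at h; omega
  have h1 : p = p' := by
    rcases lt_trichotomy p p' with hp | hp | hp
    · have := Nat.mul_le_mul_right (n + n) hp
      rw [Nat.succ_mul] at this
      omega
    · exact hp
    · have := Nat.mul_le_mul_right (n + n) hp
      rw [Nat.succ_mul] at this
      omega
  subst h1
  exact ⟨rfl, by omega⟩

/-- All entries of the table change from `old` to `new` if each of them does so whenever every entry
has its old or its new value; below the table, nothing changes. -/
theorem exec_setEntries {m n : ℕ} {ρ mem : ℕ → ℕ} (hρ : Sizes m n ρ) {e : Exp} (new : ℕ → ℕ → ℕ)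
    (h : ∀ p < n + n, ∀ q < n + n, ∀ mem' : ℕ → ℕ, (∀ a < 2 + n * m, mem' a = mem a) →
      (∀ p' < n + n, ∀ q' < n + n, mem' (cell m n p' q') = mem (cell m n p' q') ∨
        mem' (cell m n p' q') = new p' q') → mem' (cell m n p q) = mem (cell m n p q) →
      e.eval mem' (Function.update (Function.update ρ 10 p) 11 q) = new p q) :
    (∀ a < 2 + n * m, (Cmd.setEntries e).exec ρ mem a = mem a) ∧
      ∀ p < n + n, ∀ q < n + n, (Cmd.setEntries e).exec ρ mem (cell m n p q) = new p q := by
  -- the entries before the position `(i, j)` are new, the others are old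
  let inv (i j : ℕ) (mem' : ℕ → ℕ) : Prop := (∀ a < 2 + n * m, mem' a = mem a) ∧
    ∀ p < n + n, ∀ q < n + n, mem' (cell m n p q) =
      if p < i ∨ (p = i ∧ q < j) then new p q else mem (cell m n p q)
  have row : ∀ i < n + n, ∀ mem', inv i 0 mem' → ∀ j ≤ n + n, inv i j
      (Cmd.iter (.store (.entry (.var 10) (.var 11)) e) 11 (Function.update ρ 10 i) mem' j) := by
    intro i hi mem' h0 j
    induction j with
    | zero => exact fun _ => h0
    | succ j ih =>
      intro hj
      obtain ⟨h1, h2⟩ := ih (by omega)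
      rw [Cmd.iter_succ]
      set mem₁ := Cmd.iter (.store (.entry (.var 10) (.var 11)) e) 11 (Function.update ρ 10 i) mem' j
      have hρ' := (hρ.update (by omega : 3 < 10) i).update (by omega : 3 < 11) j
      have haddr : (Exp.entry (.var 10) (.var 11)).eval mem₁
          (Function.update (Function.update ρ 10 i) 11 j) = cell m n i j := by
        simp only [Exp.entry, Exp.eval, hρ'.two, hρ'.three, cell]
        simp
      have hval := h i hi j hj mem₁ h1 (fun p hp q hq => by
        rw [h2 p hp q hq]
        split_ifs
        · exact Or.inr rfl
        · exact Or.inl rfl) (by rw [h2 i hi j hj, if_neg (by omega)])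
      rw [Cmd.exec, haddr, hval]
      refine ⟨fun a ha => ?_, fun p hp q hq => ?_⟩
      · rw [Function.update_of_ne (by unfold cell; omega), h1 a ha]
      · by_cases he : p = i ∧ q = j
        · obtain ⟨rfl, rfl⟩ := he
          rw [Function.update_self, if_pos (by omega)]
        · rw [Function.update_of_ne (fun e => he (cell_inj hq hj e)), h2 p hp q hq]
          exact if_congr (by omega) rfl rfl
  have all : ∀ i ≤ n + n, inv i 0
      (Cmd.iter (.loop 11 2 (.store (.entry (.var 10) (.var 11)) e)) 10 ρ mem i) := by
    intro i
    induction i with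
    | zero => exact fun _ => ⟨fun _ _ => rfl, fun p _ q _ => by simp⟩
    | succ i ih =>
      intro hi
      obtain ⟨h1, h2⟩ := row i hi _ (ih (by omega)) (n + n) le_rfl
      rw [Cmd.iter_succ, Cmd.exec_loop, (hρ.update (by omega : 3 < 10) i).two]
      refine ⟨h1, fun p hp q hq => ?_⟩
      rw [h2 p hp q hq]
      exact if_congr (by omega) rfl rfl
  obtain ⟨h1, h2⟩ := all (n + n) le_rfl
  rw [Cmd.setEntries, Cmd.exec_loop, hρ.two]
  refine ⟨h1, fun p hp q hq => ?_⟩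
  rw [h2 p hp q hq, if_pos (Or.inl hp)]

/-- A round of Warshall's algorithm. -/
theorem exec_addPaths {m n : ℕ} {ρ mem : ℕ → ℕ} (hρ : Sizes m n ρ) {k : ℕ} (hk : k < n + n) :
    (∀ a < 2 + n * m, Cmd.addPaths.exec (Function.update ρ 12 k) mem a = mem a) ∧
      ∀ p < n + n, ∀ q < n + n,
        (Cmd.addPaths.exec (Function.update ρ 12 k) mem (cell m n p q) ≠ 0 ↔
          mem (cell m n p q) ≠ 0 ∨ (mem (cell m n p k) ≠ 0 ∧ mem (cell m n k q) ≠ 0)) := by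
  have hρ' := hρ.update (by omega : 3 < 12) k
  obtain ⟨h1, h2⟩ := exec_setEntries hρ' (mem := mem) (e := Exp.toBool (.add
      (.load (.entry (.var 10) (.var 11)))
      (.mul (.load (.entry (.var 10) (.var 12))) (.load (.entry (.var 12) (.var 11))))))
    (fun p q => 1 - (1 - (mem (cell m n p q) + mem (cell m n p k) * mem (cell m n k q))))
    (by
      intro p hp q hq mem' _ hmix hold
      have hρ'' := (hρ'.update (by omega : 3 < 10) p).update (by omega : 3 < 11) q
      rw [Exp.eval_toBool_eq_iff]
      -- row `k` and column `k` do not change in this round, up to the value of nonzero entries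
      have e1 : mem' (cell m n p k) ≠ 0 ↔ mem (cell m n p k) ≠ 0 := by
        rcases hmix p hp k hk with h | h
        · rw [h]
        · rw [h]
          rcases Nat.eq_zero_or_pos (mem (cell m n p k)) with h0 | h0
          · simp [h0]
          · omega
      have e2 : mem' (cell m n k q) ≠ 0 ↔ mem (cell m n k q) ≠ 0 := by
        rcases hmix k hk q hq with h | h
        · rw [h]
        · rw [h]
          rcases Nat.eq_zero_or_pos (mem (cell m n k q)) with h0 | h0
          · simp [h0]
          · omega
      have e3 : ∀ x y z : ℕ, x + y * z ≠ 0 ↔ x ≠ 0 ∨ (y ≠ 0 ∧ z ≠ 0) := by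
        intro x y z
        rw [← mul_ne_zero_iff]
        omega
      simp only [Exp.eval, Exp.entry, hρ''.two, hρ''.three]
      simp only [Function.update_self, Function.update_of_ne (by omega : (10 : ℕ) ≠ 11),
        Function.update_of_ne (by omega : (12 : ℕ) ≠ 11),
        Function.update_of_ne (by omega : (12 : ℕ) ≠ 10)]
      change mem' (cell m n p q) + mem' (cell m n p k) * mem' (cell m n k q) ≠ 0 ↔ _
      rw [e3, e3, e1, e2, hold])
  refine ⟨h1, fun p hp q hq => ?_⟩
  rw [Cmd.addPaths, h2 p hp q hq, ← mul_ne_zero_iff]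
  omega

/-- The command records in cell `0` whether the votes are separable relative to `a` and `b`, and
leaves the votes in the memory intact. -/
theorem exec_separable {m n : ℕ} {ρ mem : ℕ → ℕ} (hρ : Sizes m n ρ) {u : ℕ → Fin m → ℕ}
    (hu : HoldsVotes n u mem) {a b : ℕ} (ha : a < 10) (hb : b < 10) (han : 0 < n → ρ a < n)
    (hbn : 0 < n → ρ b < n) :
    HoldsVotes n u ((Cmd.separable a b).exec ρ mem) ∧ (Cmd.separable a b).exec ρ mem 0 =
      1 - (1 - (mem 0 + by classical exact if Separable n u (ρ a) (ρ b) then 1 else 0)) := by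
  classical
  set K₁ : ℕ → ℕ → Prop := fun i j => Conflict (u (ρ a)) (u i) (u j)
  set K₂ : ℕ → ℕ → Prop := fun i j => Conflict (u (ρ b)) (u i) (u j)
  obtain ⟨f1, f2⟩ := exec_setEntries hρ (mem := mem) (e := (Exp.edge a b).toBool)
    (fun p q => 1 - (1 - if ClauseEdge n K₁ K₂ p q then 1 else 0))
    (by
      intro p hp q hq mem' hmem' _ _
      rw [Exp.eval_toBool_eq_iff,
        edge_ne_zero hρ (hu.congr fun a _ h => hmem' a h) ha hb han hbn hp hq]
      simp [K₁, K₂])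
  set mem₁ := (Cmd.setEntries (Exp.edge a b).toBool).exec ρ mem
  have w : ∀ k ≤ n + n, ∀ a < 2 + n * m, Cmd.addPaths.iter 12 ρ mem₁ k a = mem a := by
    intro k
    induction k with
    | zero => exact fun _ => f1
    | succ k ih =>
      intro hk a ha
      rw [Cmd.iter_succ, (exec_addPaths hρ hk).1 a ha, ih (by omega) a ha]
  have w1 := w _ le_rfl
  have w2 : ∀ p < n + n, ∀ q < n + n, Cmd.addPaths.iter 12 ρ mem₁ (n + n) (cell m n p q) ≠ 0 ↔
      Relation.TransGen (ClauseEdge n K₁ K₂) p q := by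
    intro p hp q hq
    refine warshall (R := fun k p q => Cmd.addPaths.iter 12 ρ mem₁ k (cell m n p q) ≠ 0)
      (fun k hk p hp q hq => ?_) (fun p q h => ?_) (fun p hp q hq => ?_) hp hq
    · rw [Cmd.iter_succ]
      exact (exec_addPaths hρ hk).2 p hp q hq
    · rcases h with h | h <;> omega
    · rw [Cmd.iter_zero, f2 p hp q hq]
      split_ifs with h <;> simp [h]
  set mem₂ := Cmd.addPaths.iter 12 ρ mem₁ (n + n)
  have hexec : (Cmd.separable a b).exec ρ mem = Function.update mem₂ 0
      ((Exp.toBool (.add (.load (.const 0)) (.sub (.const 1) .contradiction))).eval mem₂ ρ) := by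
    rw [Cmd.separable, Cmd.exec, Cmd.exec, Cmd.exec_loop, hρ.two]
    rfl
  have hcontra : Exp.contradiction.eval mem₂ ρ ≠ 0 ↔ ¬ Separable n u (ρ a) (ρ b) := by
    rw [Separable, exists_partition_iff (K₁ := K₁) (K₂ := K₂) (fun _ _ => Conflict.symm)
      (fun _ _ => Conflict.symm), not_not, Exp.contradiction, Exp.eval_search_ne_zero, hρ.one]
    refine exists_congr fun i => and_congr_right fun hi => ?_
    have hρ' := hρ.update (by omega : 3 < 10) i
    rw [← w2 i (by omega) (n + i) (by omega), ← w2 (n + i) (by omega) i (by omega),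
      Exp.eval_mul_ne_zero]
    simp only [Exp.eval, Exp.entry, hρ'.one, hρ'.two, hρ'.three, Function.update_self, cell]
  rw [hexec]
  refine ⟨hu.congr fun a h1 h2 => ?_, ?_⟩
  · rw [Function.update_of_ne (by omega), w1 a h2]
  · rw [Function.update_self, Exp.eval_toBool_eq_iff, Exp.eval_add_ne_zero, Exp.eval_sub_ne_zero]
    simp only [Exp.eval]
    rw [w1 0 (by omega)]
    split_ifs with h
    · have : Exp.contradiction.eval mem₂ ρ = 0 := by
        by_contra h0
        exact hcontra.1 h0 h
      omega
    · have := hcontra.2 h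
      omega

/-- If the search is successful, then its value minus one is a number that was searched for. -/
theorem Exp.search_sub_one {mem ρ : ℕ → ℕ} {x N : ℕ} {e : Exp} {v : ℕ}
    (hv : (Exp.sub (.search x N e) (.const 1)).eval mem ρ = v) :
    (0 < ρ N → v < ρ N) ∧ ((∃ k < ρ N, e.eval mem (Function.update ρ x k) ≠ 0) →
      e.eval mem (Function.update ρ x v) ≠ 0) := by
  simp only [Exp.eval] at hv
  have hle := Nat.findGreatest_le (P := fun k => e.eval mem (Function.update ρ x (k - 1)) ≠ 0) (ρ N)
  refine ⟨fun h => by omega, fun h => ?_⟩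
  rw [← Exp.eval_search_ne_zero, Exp.eval] at h
  rw [← hv]
  exact Nat.findGreatest_of_ne_zero (P := fun k => e.eval mem (Function.update ρ x (k - 1)) ≠ 0)
    rfl h

/-- The variables `4`, `5` and `6` hold the numbers of three worst-diverse votes, if there are
any. -/
structure VotesFound (m n : ℕ) (mem ρ : ℕ → ℕ) : Prop where
  sizes : Sizes m n ρ
  lt : 0 < n → ρ 4 < n ∧ ρ 5 < n ∧ ρ 6 < n
  worstDiverse : (∃ i < n, ∃ j < n, ∃ k < n,
      WorstDiverse (vote mem m i) (vote mem m j) (vote mem m k)) →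
    WorstDiverse (vote mem m (ρ 4)) (vote mem m (ρ 5)) (vote mem m (ρ 6))

/-- The variables `4`, `5` and `6` get the numbers of worst-diverse votes, if there are any. Each
search keeps the votes found before, and asks whether the missing ones can be added. -/
theorem exec_findVotes {m n : ℕ} {mem ρ : ℕ → ℕ} (hρ : Sizes m n ρ) :
    ∃ ρ', VotesFound m n mem ρ' ∧ (∀ B, n ≤ B → Cmd.testPairs.Safe B ρ' mem →
      Cmd.findVotes.Safe B ρ mem) ∧ Cmd.findVotes.exec ρ mem = Cmd.testPairs.exec ρ' mem := by
  have wd : ∀ {ρ a b c}, ρ 0 = m → a < 20 → b < 20 → c < 20 →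
      ((Exp.worstDiverse (.var a) (.var b) (.var c)).eval mem ρ ≠ 0 ↔
        WorstDiverse (vote mem m (ρ a)) (vote mem m (ρ b)) (vote mem m (ρ c))) :=
    fun h0 ha hb hc =>
      Exp.worstDiverse_ne_zero h0 (Exp.fresh_var ha) (Exp.fresh_var hb) (Exp.fresh_var hc)
  obtain ⟨v₁, hv₁⟩ : ∃ v, (Exp.sub (.search 7 1 (.search 8 1 (.search 9 1
    (.worstDiverse (.var 7) (.var 8) (.var 9))))) (.const 1)).eval mem ρ = v := ⟨_, rfl⟩
  set ρ₁ := Function.update ρ 4 v₁ with hρ₁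
  obtain ⟨v₂, hv₂⟩ : ∃ v, (Exp.sub (.search 8 1 (.search 9 1
    (.worstDiverse (.var 4) (.var 8) (.var 9)))) (.const 1)).eval mem ρ₁ = v := ⟨_, rfl⟩
  set ρ₂ := Function.update ρ₁ 5 v₂ with hρ₂
  obtain ⟨v₃, hv₃⟩ : ∃ v, (Exp.sub (.search 9 1
    (.worstDiverse (.var 4) (.var 5) (.var 9))) (.const 1)).eval mem ρ₂ = v := ⟨_, rfl⟩
  set ρ₃ := Function.update ρ₂ 6 v₃ with hρ₃
  have s₁ : Sizes m n ρ₁ := hρ.update (by omega) _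
  have s₂ : Sizes m n ρ₂ := s₁.update (by omega) _
  have s₃ : Sizes m n ρ₃ := s₂.update (by omega) _
  obtain ⟨a₁, b₁⟩ := Exp.search_sub_one hv₁
  obtain ⟨a₂, b₂⟩ := Exp.search_sub_one hv₂
  obtain ⟨a₃, b₃⟩ := Exp.search_sub_one hv₃
  simp only [Exp.eval_search_ne_zero, hρ.one, s₁.one, s₂.one, Function.update_of_ne,
    (by decide : (1 : ℕ) ≠ 7), (by decide : (1 : ℕ) ≠ 8), ne_eq, not_false_eq_true] at a₁ b₁ a₂ b₂ a₃ b₃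
  have hle : ∀ {x e ρ v}, ρ 1 = n → (Exp.sub (.search x 1 e) (.const 1)).eval mem ρ = v → v ≤ n := by
    intro x e ρ v h1 hv
    rw [← hv, ← h1]
    exact (Nat.sub_le _ _).trans (Nat.findGreatest_le _)
  refine ⟨ρ₃, ⟨s₃, fun hn => ?_, fun h => ?_⟩, fun B hB hs => ?_, ?_⟩
  · simp [hρ₁, hρ₂, hρ₃, a₁ hn, a₂ hn, a₃ hn]
  · obtain ⟨i, hi, j, hj, k, hk, h⟩ := h
    have e1 := b₁ ⟨i, hi, j, hj, k, hk, by
      rw [← ne_eq, wd (by simp [hρ.zero]) (by omega) (by omega) (by omega)]; simpa using h⟩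
    obtain ⟨j, hj, k, hk, e1⟩ := e1
    rw [← ne_eq, wd (by simp [hρ.zero]) (by omega) (by omega) (by omega)] at e1
    have e2 := b₂ ⟨j, hj, k, hk, by
      rw [← ne_eq, wd (by simp [s₁.zero]) (by omega) (by omega) (by omega)]; simpa [hρ₁] using e1⟩
    obtain ⟨k, hk, e2⟩ := e2
    rw [← ne_eq, wd (by simp [s₁.zero]) (by omega) (by omega) (by omega)] at e2
    have e3 := b₃ ⟨k, hk, by
      rw [← ne_eq, wd (by simp [s₂.zero]) (by omega) (by omega) (by omega)]
      simpa [hρ₁, hρ₂] using e2⟩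
    rw [← ne_eq, wd (by simp [s₂.zero]) (by omega) (by omega) (by omega)] at e3
    simpa [hρ₁, hρ₂, hρ₃] using e3
  · simp only [Cmd.findVotes, Cmd.Safe, hv₁]
    refine ⟨(hle hρ.one hv₁).trans hB, ?_⟩
    rw [hv₂]
    refine ⟨(hle s₁.one hv₂).trans hB, ?_⟩
    rw [hv₃]
    exact ⟨(hle s₂.one hv₃).trans hB, hs⟩
  · simp only [Cmd.findVotes, Cmd.exec, hv₁]
    rw [hv₂, hv₃]

theorem safe_testPairs (B : ℕ) (ρ mem : ℕ → ℕ) : Cmd.testPairs.Safe B ρ mem := by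
  simp [Cmd.testPairs, Cmd.separable, Cmd.addPaths, Cmd.setEntries, Cmd.Safe, Exp.toBool, Exp.small]

theorem exec_testPairs {m n : ℕ} {mem ρ : ℕ → ℕ} (hρ : VotesFound m n mem ρ)
    (hu : ∀ i < n, (vote mem m i).Injective) :
    Cmd.testPairs.exec ρ mem 0 = 1 ∧ TwoAxes n (vote mem m) ∨
      Cmd.testPairs.exec ρ mem 0 = 0 ∧ ¬ TwoAxes n (vote mem m) := by
  classical
  have h4 := fun h => (hρ.lt h).1
  have h5 := fun h => (hρ.lt h).2.1
  have h6 := fun h => (hρ.lt h).2.2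
  set mem₀ := Function.update mem 0 0
  have u₀ : HoldsVotes n (vote mem m) mem₀ :=
    HoldsVotes.congr (fun _ _ => rfl) fun a ha _ => Function.update_of_ne (by omega) _ _
  obtain ⟨u₁, e₁⟩ := exec_separable hρ.sizes u₀ (by omega : 4 < 10) (by omega : 5 < 10) h4 h5
  obtain ⟨u₂, e₂⟩ := exec_separable hρ.sizes u₁ (by omega : 4 < 10) (by omega : 6 < 10) h4 h6
  obtain ⟨-, e₃⟩ := exec_separable hρ.sizes u₂ (by omega : 5 < 10) (by omega : 6 < 10) h5 h6
  have hexec : Cmd.testPairs.exec ρ mem = (Cmd.separable 5 6).exec ρ ((Cmd.separable 4 6).exec ρ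
    ((Cmd.separable 4 5).exec ρ mem₀)) := rfl
  have hiff : TwoAxes n (vote mem m) ↔ Separable n (vote mem m) (ρ 4) (ρ 5) ∨
      Separable n (vote mem m) (ρ 4) (ρ 6) ∨ Separable n (vote mem m) (ρ 5) (ρ 6) := by
    rcases Nat.eq_zero_or_pos n with rfl | hn
    · have h : ∀ a b, Separable 0 (vote mem m) a b := fun a b =>
        ⟨fun _ => True, fun i hi => absurd hi (Nat.not_lt_zero i)⟩
      have h' : TwoAxes 0 (vote mem m) := by
        refine ⟨fun _ => True, ?_, ?_⟩ <;>
          exact ⟨fun c => (c : ℕ), fun a b h => by simpa [Fin.val_inj] using h,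
            fun w ⟨i, hi, _⟩ => absurd hi (Nat.not_lt_zero i)⟩
      simp [h, h']
    · refine twoAxes_iff hu (h4 hn) (h5 hn) (h6 hn) ?_
      by_contra! hcon
      obtain ⟨h1, i, hi, j, hj, k, hk, h2⟩ := hcon
      exact h1 (hρ.worstDiverse ⟨i, hi, j, hj, k, hk, h2⟩)
  have hz : mem₀ 0 = 0 := Function.update_self _ _ _
  rw [hexec, e₃, e₂, e₁, hz, hiff]
  split_ifs with h1 h2 h3 h2 h3 h2 h3 <;> simp [*]

/-- Cell `0` finally holds the answer. The address of the table is why values can be quadratic. -/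
theorem exec_twoAxes {m n : ℕ} {mem : ℕ → ℕ} (h0 : mem 0 = m) (h1 : mem 1 * (1 - (1 - m)) = n)
    (hu : ∀ i < n, (vote mem m i).Injective) :
    (Cmd.twoAxes.exec (fun _ => 0) mem 0 = 1 ∧ TwoAxes n (vote mem m) ∨
      Cmd.twoAxes.exec (fun _ => 0) mem 0 = 0 ∧ ¬ TwoAxes n (vote mem m)) ∧
    ∀ B, (mem 1 + m + 2) ^ 2 ≤ B → Cmd.twoAxes.Safe B (fun _ => 0) mem := by
  set ρ : ℕ → ℕ := Function.update (Function.update (Function.update (Function.update (fun _ => 0)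
    0 m) 1 n) 2 (n + n)) 3 (2 + n * m) with hρdef
  have hρ : Sizes m n ρ := ⟨by simp [hρdef], by simp [hρdef], by simp [hρdef], by simp [hρdef]⟩
  obtain ⟨ρ', hρ', hsafe, hexec⟩ := exec_findVotes (mem := mem) hρ
  constructor
  · have : Cmd.twoAxes.exec (fun _ => 0) mem = Cmd.findVotes.exec ρ mem := by
      simp [Cmd.twoAxes, Cmd.exec, Exp.eval, Exp.toBool, h0, h1, hρdef]
    rw [this, hexec]
    exact exec_testPairs hρ' hu
  · intro B hB
    have hn : n ≤ mem 1 := by rw [← h1]; exact (Nat.mul_le_mul_left _ (by omega)).trans_eq (mul_one _)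
    have h2 : n * m ≤ mem 1 * m := Nat.mul_le_mul_right m hn
    have := hsafe B (by nlinarith) (safe_testPairs _ _ _)
    simp [Cmd.twoAxes, Cmd.Safe, Exp.eval, Exp.toBool, h0, h1, ← hρdef, this]
    refine ⟨by nlinarith, by nlinarith, by nlinarith, by nlinarith⟩

/-! ### The running time -/

theorem Exp.cost_search_le {x N : ℕ} {e : Exp} {ρ : ℕ → ℕ} {b : ℕ}
    (h : ∀ k, e.cost (Function.update ρ x k) ≤ b) :
    (Exp.search x N e).cost ρ ≤ ρ N * (b + 7) + 4 := by
  rw [Exp.cost]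
  refine Nat.add_le_add_right ((Finset.sum_le_card_nsmul _ _ (b + 7) fun k _ => ?_).trans ?_) 4
  · exact Nat.add_le_add_right (h k) 7
  · simp

theorem Cmd.cost_loop_le {x N : ℕ} {c : Cmd} {ρ mem : ℕ → ℕ} {b : ℕ}
    (h : ∀ k mem', c.cost (Function.update ρ x k) mem' ≤ b) :
    (Cmd.loop x N c).cost ρ mem ≤ ρ N * (b + 5) + 3 := by
  rw [Cmd.cost]
  refine Nat.add_le_add_right ((Finset.sum_le_card_nsmul _ _ (b + 5) fun k _ => ?_).trans ?_) 3
  · exact Nat.add_le_add_right (h k _) 5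
  · simp

/-- The time of a search among the candidates, if the body takes time `c * (m + 1) ^ k`. -/
theorem Exp.cost_search_candidates_le {m c k x : ℕ} {e : Exp} {ρ : ℕ → ℕ} (hm : ρ 0 = m)
    (hx : x ≠ 0) (h : ∀ ρ : ℕ → ℕ, ρ 0 = m → e.cost ρ ≤ c * (m + 1) ^ k) :
    (Exp.search x 0 e).cost ρ ≤ (c + 7) * (m + 1) ^ (k + 1) := by
  refine (Exp.cost_search_le fun j => h _ ?_).trans ?_
  · rw [Function.update_of_ne hx.symm, hm]
  · have h1 : 1 ≤ (m + 1) ^ k := Nat.one_le_pow _ _ (by omega)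
    rw [hm, pow_succ]
    nlinarith

/-- Repeating `n` times what takes time `c * (n ^ i * t) + d`: the lower-order term is absorbed by the
leading one, which is possible for `n = 0` as well since both vanish then. -/
theorem cost_loop_step {n c d i t : ℕ} (ht : 1 ≤ t) :
    n * (c * (n ^ i * t) + d) ≤ (c + d) * (n ^ (i + 1) * t) := by
  have h1 : n * 1 ≤ n ^ (i + 1) * t := by
    refine Nat.mul_le_mul (Nat.le_self_pow (by omega) n) ht
  calc n * (c * (n ^ i * t) + d) = c * (n ^ (i + 1) * t) + d * (n * 1) := by ring
    _ ≤ c * (n ^ (i + 1) * t) + d * (n ^ (i + 1) * t) := by gcongr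
    _ = _ := by ring

theorem Exp.cost_worstDiverse_le {m : ℕ} {u₁ u₂ u₃ : Exp} (h₁ : ∀ ρ, u₁.cost ρ ≤ 3)
    (h₂ : ∀ ρ, u₂.cost ρ ≤ 3) (h₃ : ∀ ρ, u₃.cost ρ ≤ 3) {ρ : ℕ → ℕ} (hm : ρ 0 = m) :
    (worstDiverse u₁ u₂ u₃).cost ρ ≤ 221 * (m + 1) ^ 3 := by
  refine cost_search_candidates_le (c := 214) (k := 2) hm (by omega) fun ρ hm => ?_
  refine cost_search_candidates_le (c := 207) (k := 1) hm (by omega) fun ρ hm => ?_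
  refine cost_search_candidates_le (c := 200) (k := 0) hm (by omega) fun ρ hm => ?_
  have := h₁ ρ
  have := h₂ ρ
  have := h₃ ρ
  simp only [above, position, cost, pow_zero]
  omega

theorem Exp.cost_opposed_le {m : ℕ} {u u' : Exp} (h : ∀ ρ, u.cost ρ ≤ 3)
    (h' : ∀ ρ, u'.cost ρ ≤ 3) {ρ : ℕ → ℕ} (hm : ρ 0 = m) :
    (opposed u u').cost ρ ≤ 228 * (m + 1) ^ 4 := by
  refine cost_search_candidates_le (c := 221) (k := 3) hm (by omega) fun ρ hm => ?_
  refine cost_search_candidates_le (c := 214) (k := 2) hm (by omega) fun ρ hm => ?_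
  refine cost_search_candidates_le (c := 207) (k := 1) hm (by omega) fun ρ hm => ?_
  refine cost_search_candidates_le (c := 200) (k := 0) hm (by omega) fun ρ hm => ?_
  have := h ρ
  have := h' ρ
  simp only [above, position, cost, pow_zero]
  omega

theorem Exp.cost_conflict_le {m : ℕ} {v u u' : Exp} (hv : ∀ ρ, v.cost ρ ≤ 3)
    (h : ∀ ρ, u.cost ρ ≤ 3) (h' : ∀ ρ, u'.cost ρ ≤ 3) {ρ : ℕ → ℕ} (hm : ρ 0 = m) :
    (conflict v u u').cost ρ ≤ 450 * (m + 1) ^ 4 := by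
  have h1 := cost_opposed_le h h' hm
  have h2 := cost_worstDiverse_le hv h h' hm
  have h3 : (m + 1) ^ 3 ≤ (m + 1) ^ 4 := Nat.pow_le_pow_right (by omega) (by omega)
  have h4 : 1 ≤ (m + 1) ^ 4 := Nat.one_le_pow _ _ (by omega)
  simp only [conflict, cost]
  omega

theorem Exp.cost_edge_le {m : ℕ} {a b : ℕ} {ρ : ℕ → ℕ} (hm : ρ 0 = m) :
    (edge a b).cost ρ ≤ 950 * (m + 1) ^ 4 := by
  have h1 := cost_conflict_le (v := .var a) (u := .var 10) (u' := .sub (.var 11) (.var 1))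
    (by simp [cost]) (by simp [cost]) (by simp [cost]) hm
  have h2 := cost_conflict_le (v := .var b) (u := .sub (.var 10) (.var 1)) (u' := .var 11)
    (by simp [cost]) (by simp [cost]) (by simp [cost]) hm
  have h4 : 1 ≤ (m + 1) ^ 4 := Nat.one_le_pow _ _ (by omega)
  simp only [edge, cost]
  omega

theorem Cmd.cost_setEntries_le {m n c t : ℕ} (ht : 1 ≤ t) {e : Exp} {ρ mem : ℕ → ℕ}
    (hρ : Sizes m n ρ) (h : ∀ ρ, Sizes m n ρ → e.cost ρ ≤ c * t) :
    (setEntries e).cost ρ mem ≤ (4 * c + 100) * (n ^ 2 * t) + 3 := by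
  have inner : ∀ k mem', (loop 11 2 (.store (.entry (.var 10) (.var 11)) e)).cost
      (Function.update ρ 10 k) mem' ≤ (n + n) * (c * t + 13) + 3 := by
    intro k mem'
    have hρ' := hρ.update (by omega : 3 < 10) k
    refine (cost_loop_le (b := c * t + 8) fun j mem'' => ?_).trans ?_
    · have := h _ (hρ'.update (by omega : 3 < 11) j)
      simp only [cost, Exp.cost, Exp.entry]
      omega
    · rw [hρ'.two]
  refine (cost_loop_le inner).trans ?_
  rw [hρ.two]
  have h1 : n ≤ n ^ 2 * t := (Nat.le_self_pow two_ne_zero n).trans (Nat.le_mul_of_pos_right _ ht)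
  have h2 : n ^ 2 ≤ n ^ 2 * t := Nat.le_mul_of_pos_right _ ht
  calc (n + n) * ((n + n) * (c * t + 13) + 3 + 5) + 3
      = 4 * c * (n ^ 2 * t) + 52 * n ^ 2 + 16 * n + 3 := by ring
    _ ≤ 4 * c * (n ^ 2 * t) + 52 * (n ^ 2 * t) + 16 * (n ^ 2 * t) + 3 := by gcongr
    _ ≤ _ := by nlinarith [Nat.zero_le (n ^ 2 * t)]

/-- A bound for the time of the program, up to a constant factor. -/
def timeBound (m n : ℕ) : ℕ := n ^ 3 * (m + 1) ^ 3 + n ^ 2 * (m + 1) ^ 4 + 1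

theorem Cmd.cost_separable_le {m n a b : ℕ} {ρ mem : ℕ → ℕ} (hρ : Sizes m n ρ) :
    (separable a b).cost ρ mem ≤ 5000 * timeBound m n := by
  have ht : 1 ≤ (m + 1) ^ 4 := Nat.one_le_pow _ _ (by omega)
  have h1 : (setEntries (Exp.edge a b).toBool).cost ρ mem ≤ _ :=
    cost_setEntries_le ht hρ (c := 960) fun ρ hρ => by
      have := Exp.cost_edge_le (a := a) (b := b) hρ.zero
      simp only [Exp.toBool, Exp.cost]
      omega
  have h2 : ∀ mem', (loop 12 2 addPaths).cost ρ mem' ≤ (n + n) * (300 * (n ^ 2 * 1) + 3 + 5) + 3 := by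
    intro mem'
    refine (cost_loop_le (b := 300 * (n ^ 2 * 1) + 3) fun k mem'' => ?_).trans (by rw [hρ.two])
    exact cost_setEntries_le (c := 50) le_rfl (hρ.update (by omega : 3 < 12) k) fun ρ _ => by
      simp only [Exp.toBool, Exp.cost, Exp.entry]
      omega
  have h3 : Exp.contradiction.cost ρ ≤ n * 47 + 4 := by
    refine (Exp.cost_search_le (b := 40) fun k => ?_).trans (by rw [hρ.one])
    simp only [Exp.cost, Exp.entry]
    omega
  have h2 := h2 ((setEntries (Exp.edge a b).toBool).exec ρ mem)
  have h4 : n ≤ n ^ 3 * (m + 1) ^ 3 := (Nat.le_self_pow three_ne_zero n).trans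
    (Nat.le_mul_of_pos_right _ (by positivity))
  have h5 : n ^ 3 ≤ n ^ 3 * (m + 1) ^ 3 := Nat.le_mul_of_pos_right _ (by positivity)
  have h6 : (n + n) * (300 * (n ^ 2 * 1) + 3 + 5) + 3 = 600 * n ^ 3 + 16 * n + 3 := by ring
  have h7 : (4 * 960 + 100) * (n ^ 2 * (m + 1) ^ 4) + 3 = 3940 * (n ^ 2 * (m + 1) ^ 4) + 3 := by ring
  rw [separable, cost, cost, cost]
  have h8 : (Exp.toBool (.add (.load (.const 0)) (.sub (.const 1) .contradiction))).cost ρ =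
      Exp.contradiction.cost ρ + 9 := by
    simp only [Exp.toBool, Exp.cost]
    omega
  rw [h8, Exp.cost, timeBound]
  omega

theorem Cmd.cost_testPairs_le {m n : ℕ} {ρ mem : ℕ → ℕ} (hρ : Sizes m n ρ) :
    testPairs.cost ρ mem ≤ 15003 * timeBound m n := by
  have h1 := cost_separable_le (a := 4) (b := 5) (mem := (store (.const 0) (.const 0)).exec ρ mem) hρ
  have h2 := fun mem => cost_separable_le (a := 4) (b := 6) (mem := mem) hρ
  have h2 := h2 ((separable 4 5).exec ρ ((store (.const 0) (.const 0)).exec ρ mem))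
  have h3 := fun mem => cost_separable_le (a := 5) (b := 6) (mem := mem) hρ
  have h3 := h3 ((separable 4 6).exec ρ
    ((separable 4 5).exec ρ ((store (.const 0) (.const 0)).exec ρ mem)))
  have h4 : 1 ≤ timeBound m n := Nat.le_add_left _ _
  rw [testPairs, cost, cost, cost, cost, Exp.cost]
  omega

theorem Cmd.cost_findVotes_le {m n : ℕ} {ρ mem : ℕ → ℕ} (hρ : Sizes m n ρ) :
    findVotes.cost ρ mem ≤ 16003 * timeBound m n := by
  set t := (m + 1) ^ 3 with ht
  have ht1 : 1 ≤ t := Nat.one_le_pow _ _ (by omega)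
  have step1 : ∀ {a b : ℕ} {ρ : ℕ → ℕ}, Sizes m n ρ →
      (Exp.search 9 1 (.worstDiverse (.var a) (.var b) (.var 9))).cost ρ ≤ 228 * (n ^ 1 * t) + 4 :=
    fun {a b ρ} hρ => by
      refine (Exp.cost_search_le (b := 221 * t) fun k => ?_).trans ?_
      · exact Exp.cost_worstDiverse_le (by simp [Exp.cost]) (by simp [Exp.cost])
          (by simp [Exp.cost]) (hρ.update (by omega) k).zero
      · rw [hρ.one]
        have := cost_loop_step (n := n) (c := 221) (d := 7) (i := 0) ht1
        simp only [pow_zero, one_mul, zero_add] at this ⊢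
        omega
  have step2 : ∀ {a : ℕ} {ρ : ℕ → ℕ}, Sizes m n ρ →
      (Exp.search 8 1 (.search 9 1 (.worstDiverse (.var a) (.var 8) (.var 9)))).cost ρ ≤
        239 * (n ^ 2 * t) + 4 := fun {a ρ} hρ => by
      refine (Exp.cost_search_le fun k => step1 (hρ.update (by omega) k)).trans ?_
      rw [hρ.one]
      have := cost_loop_step (n := n) (c := 228) (d := 11) (i := 1) ht1
      simpa [add_assoc] using this
  have step3 : ∀ {ρ : ℕ → ℕ}, Sizes m n ρ →
      (Exp.search 7 1 (.search 8 1 (.search 9 1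
        (.worstDiverse (.var 7) (.var 8) (.var 9))))).cost ρ ≤ 250 * (n ^ 3 * t) + 4 :=
    fun {ρ} hρ => by
      refine (Exp.cost_search_le fun k => step2 (hρ.update (by omega) k)).trans ?_
      rw [hρ.one]
      have := cost_loop_step (n := n) (c := 239) (d := 11) (i := 2) ht1
      simpa [add_assoc] using this
  have h1 : n ^ 1 * t ≤ n ^ 3 * t := by
    rcases Nat.eq_zero_or_pos n with rfl | hn
    · simp
    · exact Nat.mul_le_mul_right t (Nat.pow_le_pow_right hn (by omega))
  have h2 : n ^ 2 * t ≤ n ^ 3 * t := by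
    rcases Nat.eq_zero_or_pos n with rfl | hn
    · simp
    · exact Nat.mul_le_mul_right t (Nat.pow_le_pow_right hn (by omega))
  have hT : n ^ 3 * t + 1 ≤ timeBound m n := by simp only [timeBound, ← ht]; omega
  have sub : ∀ {e : Exp} {ρ : ℕ → ℕ}, (Exp.sub e (.const 1)).cost ρ = e.cost ρ + 2 := fun {e ρ} => by
    simp only [Exp.cost]
  have c1 := step3 hρ
  rw [findVotes, cost, sub]
  have s1 := fun v => hρ.update (by omega : 3 < 4) v
  generalize (Exp.sub (.search 7 1 (.search 8 1 (.search 9 1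
    (.worstDiverse (.var 7) (.var 8) (.var 9))))) (.const 1)).eval mem ρ = v₁
  have c2 := step2 (a := 4) (s1 v₁)
  rw [cost, sub]
  have s2 := fun v => (s1 v₁).update (by omega : 3 < 5) v
  generalize (Exp.sub (.search 8 1 (.search 9 1 (.worstDiverse (.var 4) (.var 8) (.var 9))))
    (.const 1)).eval mem _ = v₂
  have c3 := step1 (a := 4) (b := 5) (s2 v₂)
  rw [cost, sub]
  generalize (Exp.sub (.search 9 1 (.worstDiverse (.var 4) (.var 5) (.var 9)))
    (.const 1)).eval mem _ = v₃
  have c4 := cost_testPairs_le (mem := mem) ((s2 v₂).update (by omega : 3 < 6) v₃)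
  omega

theorem cost_twoAxes_le {m n : ℕ} {mem : ℕ → ℕ} (h0 : mem 0 = m)
    (h1 : mem 1 * (1 - (1 - m)) = n) :
    Cmd.twoAxes.cost (fun _ => 0) mem ≤ 16050 * timeBound m n := by
  set ρ : ℕ → ℕ := Function.update (Function.update (Function.update (Function.update (fun _ => 0)
    0 m) 1 n) 2 (n + n)) 3 (2 + n * m) with hρdef
  have hρ : Sizes m n ρ := ⟨by simp [hρdef], by simp [hρdef], by simp [hρdef], by simp [hρdef]⟩
  have h := Cmd.cost_findVotes_le (mem := mem) hρ
  have h4 : 1 ≤ timeBound m n := Nat.le_add_left _ _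
  have : Cmd.twoAxes.cost (fun _ => 0) mem ≤ Cmd.findVotes.cost ρ mem + 40 := by
    simp [Cmd.twoAxes, Cmd.cost, Exp.cost, Exp.eval, Exp.toBool, h0, h1, ← hρdef]
    omega
  omega

theorem timeBound_le {m n : ℕ} (hm : 0 < m) :
    timeBound m n ≤ 16 * (n ^ 2 * m ^ 3 * (n + m) + 1) := by
  have h : m + 1 ≤ 2 * m := by omega
  calc timeBound m n ≤ n ^ 3 * (2 * m) ^ 3 + n ^ 2 * (2 * m) ^ 4 + 1 := by
        unfold timeBound; gcongr
    _ = 8 * (n ^ 3 * m ^ 3) + 16 * (n ^ 2 * m ^ 4) + 1 := by ring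
    _ ≤ 16 * (n ^ 3 * m ^ 3) + 16 * (n ^ 2 * m ^ 4) + 16 := by omega
    _ = _ := by ring

end RAM

/-! ### From elections to tables of positions -/

/-- A strict total order of a finite type is given by a function into the integers. -/
theorem exists_axis_function {C : Type*} [Fintype C] (ax : C → C → Prop)
    [IsStrictTotalOrder C ax] : ∃ f : C → ℤ, f.Injective ∧ ∀ a b, f a < f b → ax a b := by
  classical
  set f : C → ℤ := fun a => (Finset.univ.filter fun b => ax b a).card with hf
  have lt : ∀ {a b}, ax a b → f a < f b := fun {a b} h => by
    refine Nat.cast_lt.2 (Finset.card_lt_card (Finset.ssubset_iff_of_subset ?_ |>.2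
      ⟨a, by simpa using h, by simpa using irrefl_of ax a⟩))
    intro c hc
    simp only [Finset.mem_filter, Finset.mem_univ, true_and] at hc ⊢
    exact trans_of ax hc h
  refine ⟨f, fun a b h => ?_, fun a b h => ?_⟩
  · rcases trichotomous_of ax a b with h' | h' | h'
    · exact absurd (lt h') h.not_lt
    · exact h'
    · exact absurd (lt h') h.not_gt
  · rcases trichotomous_of ax a b with h' | h' | h'
    · exact h'
    · exact absurd h (by simp [h'])
    · exact absurd (lt h') h.not_gt

theorem isStrictTotalOrder_of_injective {C : Type*} {f : C → ℤ} (hf : f.Injective) :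
    IsStrictTotalOrder C fun a b => f a < f b where
  irrefl _ := lt_irrefl _
  trans _ _ _ := lt_trans
  trichotomous _ _ h h' := hf (le_antisymm (not_lt.1 h') (not_lt.1 h))

namespace Election

theorem isKAxes_two_iff (E : Election) {u : ℕ → Fin E.m → ℕ}
    (hu : ∀ (i : ℕ) (hi : i < E.n), u i = fun c => ((E.votes[i]'hi) c : ℕ)) :
    E.IsKAxes 2 ↔ TwoAxes E.n u := by
  constructor
  · rintro ⟨ax, hax, hv⟩
    have := hax 0
    have := hax 1
    have side : ∀ (s : Fin 2) (z : ℕ → Prop),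
        (∀ (i : ℕ) (hi : i < E.n), z i → SinglePeakedWrt (E.votes[i]'hi) (ax s)) →
          SinglePeaked {w | ∃ i < E.n, z i ∧ w = u i} := by
      intro s z hz
      have := hax s
      obtain ⟨f, hf, hlt⟩ := exists_axis_function (ax s)
      refine ⟨f, hf, ?_⟩
      rintro w ⟨i, hi, hzi, rfl⟩ a b c hab hbc ⟨h1, h2⟩
      rw [hu i hi] at h1 h2
      have := hz i hi hzi a b c (Or.inl ⟨hlt a b hab, hlt b c hbc⟩) h2
      exact lt_asymm this h1
    refine ⟨fun i => ∃ hi : i < E.n, SinglePeakedWrt (E.votes[i]'hi) (ax 0), side 0 _ ?_,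
      side 1 _ ?_⟩
    · exact fun i hi h => h.2
    · intro i hi h
      obtain ⟨s, hs⟩ := hv _ (List.getElem_mem hi)
      fin_cases s
      · exact absurd ⟨hi, hs⟩ h
      · exact hs
  · rintro ⟨z, ⟨f₁, hf₁, h₁⟩, f₂, hf₂, h₂⟩
    have peaked : ∀ {i : ℕ} (hi : i < E.n) {S : Set (Fin E.m → ℕ)} {f : Fin E.m → ℤ},
        PeakedAlong S f → u i ∈ S →
          SinglePeakedWrt (E.votes[i]'hi) fun a b => f a < f b := by
      intro i hi S f hp hS a b c hax hcb
      by_contra hab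
      have hne : a ≠ b := by rintro rfl; rcases hax with h | h <;> omega
      have hab : (E.votes[i]'hi) a < (E.votes[i]'hi) b :=
        lt_of_le_of_ne (not_lt.1 hab) fun e => hne ((E.votes[i]'hi).injective e)
      have h1 := hp _ hS a b c
      have h2 := hp _ hS c b a
      rw [hu i hi] at h1 h2
      rcases hax with h | h
      · exact h1 h.1 h.2 ⟨hab, hcb⟩
      · exact h2 h.1 h.2 ⟨hcb, hab⟩
    refine ⟨![fun a b => f₁ a < f₁ b, fun a b => f₂ a < f₂ b], fun s => ?_, fun π hπ => ?_⟩
    · fin_cases s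
      · exact isStrictTotalOrder_of_injective hf₁
      · exact isStrictTotalOrder_of_injective hf₂
    · obtain ⟨i, hi, rfl⟩ := List.getElem_of_mem hπ
      by_cases hz : z i
      · exact ⟨0, peaked hi h₁ ⟨i, hi, hz, rfl⟩⟩
      · exact ⟨1, peaked hi h₂ ⟨i, hi, hz, rfl⟩⟩

theorem getD_flatMap {m : ℕ} (l : List (Equiv.Perm (Fin m))) {i : ℕ} (hi : i < l.length)
    (c : Fin m) :
    (l.flatMap fun π => List.ofFn fun c => (π c : ℕ)).getD (i * m + c) 0 = l[i] c := by
  induction l generalizing i with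
  | nil => simp at hi
  | cons π l ih =>
    rw [List.flatMap_cons]
    rcases i with _ | i
    · rw [List.getD_append _ _ _ _ (by simp)]
      simp
    · rw [List.getD_append_right _ _ _ _ (by simp [Nat.succ_mul]; omega)]
      have : (i + 1) * m + c - (List.ofFn fun c => (π c : ℕ)).length = i * m + c := by
        simp [Nat.succ_mul]; omega
      rw [this]
      simpa using ih (by simpa using hi)

theorem length_flatMap_positions {m : ℕ} (l : List (Equiv.Perm (Fin m))) :
    (l.flatMap fun π => List.ofFn fun c => (π c : ℕ)).length = l.length * m := by
  simp [List.length_flatMap]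

theorem vote_encode (E : Election) {i : ℕ} (hi : i < E.n) :
    RAM.vote (fun k => E.encode.getD k 0) E.m i = fun c => ((E.votes[i]'hi) c : ℕ) := by
  funext c
  have : 2 + (i * E.m + c) = (i * E.m + c) + 1 + 1 := by omega
  simp only [RAM.vote, encode, this, List.getD_cons_succ]
  exact getD_flatMap _ hi c

theorem getD_encode_le (E : Election) (k : ℕ) : E.encode.getD k 0 ≤ E.n + E.m := by
  have mem_le : ∀ x ∈ E.encode, x ≤ E.n + E.m := by
    intro x hx
    simp only [encode, List.mem_cons, List.mem_flatMap, List.mem_ofFn] at hx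
    rcases hx with rfl | rfl | ⟨π, -, c, rfl⟩
    · omega
    · omega
    · have := (π c).2
      omega
  rcases lt_or_ge k E.encode.length with h | h
  · rw [List.getD_eq_getElem _ _ h]
    exact mem_le _ (List.getElem_mem h)
  · rw [List.getD_eq_default _ _ h]
    exact Nat.zero_le _

end Election

namespace RAM

/-! ### Solvability in polynomial time -/

theorem solvableInTime_isKAxes_two : SolvableInTime Election.encode (Election.IsKAxes 2)
    (fun E => E.n + E.m) (fun E => E.n ^ 2 * E.m ^ 3 * (E.n + E.m) + 1) := by
  refine ⟨Cmd.twoAxes.program, max (16050 * 16 + 1) (2 * (Cmd.twoAxes.deg + 1)), fun E => ?_⟩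
  set mem : ℕ → ℕ := fun k => E.encode.getD k 0 with hmem
  set n := E.n * (1 - (1 - E.m)) with hn
  have h0 : mem 0 = E.m := rfl
  have h1 : mem 1 = E.n := rfl
  have hnE : n ≤ E.n := (Nat.mul_le_mul_left _ (by omega)).trans_eq (mul_one _)
  obtain ⟨hres, hsafe⟩ := exec_twoAxes (n := n) h0 (by rw [h1]) fun i hi => by
    rw [hmem, E.vote_encode (hi.trans_le hnE)]
    exact Fin.val_injective.comp (Equiv.injective _)
  have hcost := cost_twoAxes_le (n := n) h0 (by rw [h1])
  have hiff : E.IsKAxes 2 ↔ TwoAxes n (vote mem E.m) := by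
    rw [E.isKAxes_two_iff fun i hi => E.vote_encode hi]
    rcases Nat.eq_zero_or_pos E.m with hm | hm
    · have : IsEmpty (Fin E.m) := by rw [hm]; infer_instance
      have h : ∀ n, TwoAxes n (vote mem E.m) := fun n => ⟨fun _ => True,
        ⟨isEmptyElim, fun a => isEmptyElim a, fun _ _ a => isEmptyElim a⟩,
        ⟨isEmptyElim, fun a => isEmptyElim a, fun _ _ a => isEmptyElim a⟩⟩
      exact ⟨fun _ => h n, fun _ => h E.n⟩
    · rw [hn, show 1 - (1 - E.m) = 1 by omega, mul_one]
  have htime : timeBound E.m n ≤ 16 * (E.n ^ 2 * E.m ^ 3 * (E.n + E.m) + 1) := by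
    rcases Nat.eq_zero_or_pos E.m with hm | hm
    · simp [hn, hm, timeBound]
    · rw [hn, show 1 - (1 - E.m) = 1 by omega, mul_one]
      exact timeBound_le hm
  -- memory cells and variables are at most quadratic, because of the address of the table
  have hB : 2 ≤ (E.n + E.m + 2) ^ 2 := by nlinarith
  obtain ⟨t, ht, hpc, hreg, hbd⟩ := Cmd.twoAxes.program_correct hB (w := E.encode)
    (fun k => (E.getD_encode_le k).trans (by nlinarith)) (hsafe _ (by rw [h1]))
  refine ⟨t, ?_, ⟨hpc, fun h => ?_, fun h => ?_⟩, fun s hs k => ?_⟩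
  · refine le_trans ?_ (Nat.mul_le_mul_right _ (le_max_left _ _))
    change t ≤ (16050 * 16 + 1) * (E.n ^ 2 * E.m ^ 3 * (E.n + E.m) + 1)
    change t ≤ Cmd.twoAxes.cost (fun _ => 0) mem + 1 at ht
    omega
  · rw [hreg]
    rcases hres with hres | hres
    · exact hres.1
    · exact absurd (hiff.1 h) hres.2
  · rw [hreg]
    rcases hres with hres | hres
    · exact absurd (hiff.2 hres.2) h
    · exact hres.1
  · have hW : ((E.n + E.m + 2) ^ 2) ^ (Cmd.twoAxes.deg + 1) ≤
        (E.n + E.m + 2) ^ max (16050 * 16 + 1) (2 * (Cmd.twoAxes.deg + 1)) := by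
      rw [← pow_mul]
      exact Nat.pow_le_pow_right (by omega) (le_max_right _ _)
    exact ⟨((hbd s hs) k).1.trans hW, ((hbd s hs) k).2.trans hW⟩

theorem size_pow_le (a c : ℕ) : Nat.size (a ^ c) ≤ c * Nat.size a + 1 := by
  rw [Nat.size_le]
  calc a ^ c ≤ (2 ^ Nat.size a) ^ c := Nat.pow_le_pow_left (Nat.lt_size_self a).le c
    _ = 2 ^ (c * Nat.size a) := by rw [← pow_mul, mul_comm]
    _ < 2 ^ (c * Nat.size a + 1) := Nat.pow_lt_pow_right (by omega) (by omega)

/-- The configuration after the step is needed for the constant that an instruction may write. -/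
theorem stepCost_le {P : Program} {c : Config} {W : ℕ} (hc : c.Bounded W)
    (hc' : (step P c).Bounded W) : stepCost P c ≤ 2 * Nat.size W + 1 := by
  have hs : ∀ {k}, k ≤ W → Nat.size k ≤ Nat.size W := fun h => Nat.size_le_size h
  have r := fun k => hs (hc k).1
  have m := fun k => hs (hc k).2
  unfold stepCost
  unfold step at hc'
  split <;> rename_i h
  · omega
  · rename_i i
    rw [h] at hc'
    cases i with
    | const a k =>
      have : Nat.size k ≤ Nat.size W := by
        have := hs (hc' a).1
        simpa [Instr.exec, Config.setReg] using this
      simp only [Instr.logCost]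
      omega
    | copy a s => have := r s; simp only [Instr.logCost]; omega
    | add a s t => have := r s; have := r t; simp only [Instr.logCost]; omega
    | sub a s t => have := r s; have := r t; simp only [Instr.logCost]; omega
    | mul a s t => have := r s; have := r t; simp only [Instr.logCost]; omega
    | load a s => have := r s; have := m (c.reg s); simp only [Instr.logCost]; omega
    | store a s => have := r a; have := r s; simp only [Instr.logCost]; omega
    | jump l => simp only [Instr.logCost]; omega
    | jumpZero a l => have := r a; simp only [Instr.logCost]; omega

/-- A problem that is solvable in time `T` with short words is solvable in polynomial time if `T`
and the word length are polynomially bounded in the bit length of the input. -/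
theorem SolvableInTime.polyTimeSolvable {α : Type*} {enc : α → List ℕ} {L : α → Prop}
    {N T : α → ℕ} (h : SolvableInTime enc L N T) (p : Polynomial ℕ)
    (hT : ∀ x, T x ≤ p.eval (bitLength (enc x))) (hN : ∀ x, Nat.size (N x + 2) ≤ bitLength (enc x)) :
    PolyTimeSolvable enc L := by
  obtain ⟨P, C, h⟩ := h
  refine ⟨P, .C C * p * (2 * (.C C * .X + 1) + 1), fun x => ?_⟩
  obtain ⟨t, ht, hans, hbd⟩ := h x
  have hsucc : ∀ s, run P (enc x) (s + 1) = step P (run P (enc x) s) := fun s => by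
    simp only [run, Function.iterate_succ_apply']
  refine ⟨t, hans, ?_⟩
  have hb : ∀ s ≤ t, (run P (enc x) s).Bounded ((N x + 2) ^ C) := fun s hs k => hbd s hs k
  calc ∑ s ∈ Finset.range t, stepCost P (run P (enc x) s)
      ≤ ∑ s ∈ Finset.range t, (2 * (C * bitLength (enc x) + 1) + 1) := by
        refine Finset.sum_le_sum fun s hs => ?_
        have hs := Finset.mem_range.1 hs
        refine (stepCost_le (hb s hs.le) (by rw [← hsucc]; exact hb (s + 1) hs)).trans ?_
        have := (size_pow_le (N x + 2) C).trans
          (Nat.add_le_add_right (Nat.mul_le_mul_left C (hN x)) 1)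
        omega
    _ = t * (2 * (C * bitLength (enc x) + 1) + 1) := by simp
    _ ≤ (C * p.eval (bitLength (enc x))) * (2 * (C * bitLength (enc x) + 1) + 1) :=
        Nat.mul_le_mul_right _ (ht.trans (Nat.mul_le_mul_left C (hT x)))
    _ = _ := by simp

theorem size_add_two_le (a b : ℕ) : Nat.size (a + b + 2) ≤ Nat.size a + Nat.size b + 2 := by
  rw [Nat.size_le]
  have h1 : a + 1 ≤ 2 ^ Nat.size a := Nat.lt_size_self a
  have h2 : b + 1 ≤ 2 ^ Nat.size b := Nat.lt_size_self b
  have h3 : 2 ^ Nat.size a ≤ 2 ^ (Nat.size a + Nat.size b) := Nat.pow_le_pow_right (by omega) (by omega)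
  have h4 : 2 ^ Nat.size b ≤ 2 ^ (Nat.size a + Nat.size b) := Nat.pow_le_pow_right (by omega) (by omega)
  have h5 : 1 ≤ 2 ^ (Nat.size a + Nat.size b) := Nat.one_le_two_pow
  rw [pow_succ, pow_succ]
  omega

theorem length_le_bitLength (w : List ℕ) : w.length ≤ bitLength w := by
  induction w with
  | nil => simp
  | cons a w ih =>
    simp only [bitLength, List.map_cons, List.sum_cons, List.length_cons] at ih ⊢
    omega

end RAM

theorem mainTheorem8 :
    RAM.PolyTimeSolvable Election.encode (Election.IsKAxes 2) ∧
      RAM.SolvableInTime Election.encode (Election.IsKAxes 2)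
        (fun E => E.n + E.m)
        (fun E => E.n ^ 2 * E.m ^ 3 * (E.n + E.m) + 1) := by
  refine ⟨RAM.solvableInTime_isKAxes_two.polyTimeSolvable (2 * .X ^ 6 + 1) (fun E => ?_)
    (fun E => ?_), RAM.solvableInTime_isKAxes_two⟩
  · rcases Nat.eq_zero_or_pos E.n with hn | hn
    · simp [hn]
    rcases Nat.eq_zero_or_pos E.m with hm | hm
    · simp [hm]
    -- both numbers are bounded by the length of the table of positions
    have hlen : E.n * E.m ≤ RAM.bitLength E.encode := by
      refine le_trans ?_ (RAM.length_le_bitLength _)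
      simp only [Election.encode, List.length_cons, Election.length_flatMap_positions, Election.n]
      omega
    set b := RAM.bitLength E.encode
    have h1 : E.n ≤ b := (Nat.le_mul_of_pos_right _ hm).trans hlen
    have h2 : E.m ≤ b := (Nat.le_mul_of_pos_left _ hn).trans hlen
    calc E.n ^ 2 * E.m ^ 3 * (E.n + E.m) + 1 ≤ b ^ 2 * b ^ 3 * (b + b) + 1 := by gcongr
      _ = 2 * b ^ 6 + 1 := by ring
      _ = _ := by simp
  · refine (RAM.size_add_two_le _ _).trans ?_
    simp only [Election.encode, RAM.bitLength, List.map_cons, List.sum_cons]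
    omega
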